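/- **Setting.** Let $N\ge 2$, and let $\mathcal G$ be a directed graph on $N$ nodes with weights $a_{ij}\ge 0$ (an edge from $j$ to $i$ exists iff $a_{ij}>0$) that contains a spanning tree, i.e. some node has a directed path to every other node. Let $\mathcal L=\operatorname{diag}\big(\sum_j a_{ij}\big)-[a_{ij}]$ be its Laplacian, with eigenvalues $\lambda_1=0,\lambda_2,\dots,\lambda_N\in\mathbb C$ counted with algebraic multiplicity. Let $A\in\mathbb R^{n\times n}$ and $B\in\mathbb R^{n\times m}$ with $(A,B)$ controllable, $Q=C^TC$ with $(A,C)$ observable, $\gamma>0$ and $\mu\ge 1$. **First SDP.** In the variables $H=\begin{bmatrix}H_{11}&H_{12}\\H_{12}^T&H_{22}\end{bmatrix}\in\mathbb S^{n+m}$ and $W\in\mathbb R^{n\times n}$, maximize $\operatorname{trace}(W)$ subject to $$\begin{bmatrix}H_{11}-W&H_{12}\\H_{12}^T&H_{22}\end{bmatrix}\succeq0,\qquad \begin{bmatrix}\mu^2[A\ B]^TH_{11}[A\ B]-H+\begin{bmatrix}Q&0\\0&\gamma I_m\end{bmatrix}&\mu[A\ B]^TH_{12}\\ \mu H_{12}^T[A\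 B]&H_{22}\end{bmatrix}\succeq0 .$$ Let $H$ be the solution of this SDP that is the matrix of the optimal Q-function of the infinite-horizon LQR problem with dynamics $(\mu A,\mu B)$ and weights $Q$ and $R=\gamma I_m$; that is, $$\begin{bmatrix}x\\u\end{bmatrix}^TH\begin{bmatrix}x\\u\end{bmatrix}=x^TQx+\gamma u^Tu+V^*(\mu Ax+\mu Bu)\quad\text{for all }x\in\mathbb R^n,\ u\in\mathbb R^m,$$ where $V^*$ is the optimal value function. Exactly one symmetric matrix $H$ satisfies this identity and is part of an optimal solution $(H,W)$. **Second SDP.** For this fixed $H$, in the variables $\beta,\hat c\in\mathbb R$, maximize $\beta$ subject to $$\begin{bmatrix}Q&\beta H_{12}\\ \beta H_{12}^T&H_{22}\end{bmatrix}\succeq0,\qquad \begin{bmatrix}\beta-\sqrt{1-\frac{(\operatorname{Re}\lambda_i)^2}{|\lambda_i|^2}}&\frac{\hat c|\lambda_i|^2-\operatorname{Re}\lambda_i}{|\lambda_i|}\\ \frac{\hat c|\lambda_i|^2-\operatorname{Re}\lambda_i}{|\lambda_i|}&\beta+\sqrt{1-\frac{(\operatorname{Re}\lambda_i)^2}{|\lambda_i|^2}}\end{bmatrix}\succeq0\quad(i=2,\dots,N).$$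 If this SDP is feasible and $H_{12}\ne0$, then it has an optimal solution. **Theorem.** Let $(\beta^*,\hat c^*)$ be an optimal solution of the second SDP. Put $K=H_{22}^{-1}H_{12}^T$ and $c=\frac{c_1^*+c_2^*}2$, where $$c_1^*=\max_{2\le i\le N}\frac{\operatorname{Re}\lambda_i-\sqrt{(\operatorname{Re}\lambda_i)^2-|\lambda_i|^2(1-\beta^{*2})}}{|\lambda_i|^2},\qquad c_2^*=\min_{2\le j\le N}\frac{\operatorname{Re}\lambda_j+\sqrt{(\operatorname{Re}\lambda_j)^2-|\lambda_j|^2(1-\beta^{*2})}}{|\lambda_j|^2}.$$ Then the control law $u_i(k)=-cK\sum_j a_{ij}\big(x_i(k)-x_j(k)\big)$ makes the agents $x_i(k+1)=Ax_i(k)+Bu_i(k)$ reach consensus with rate $\mu$: for all initial states, $\|x_i(k)-x_j(k)\|\to0$ as $k\to\infty$ for all $i,j$, and $\rho(A-c\lambda_iBK)<1/\mu$ for $i=2,\dots,N$. -/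

import Mathlib

open Matrix Filter Topology

noncomputable section

namespace QConsensus

/-! ### Linear systems -/

/-- The pair `(A, B)` is controllable: `[B, A B, …, A ^ (n - 1) B]` has rank `n`. -/
def Controllable {n m : ℕ} (A : Matrix (Fin n) (Fin n) ℝ) (B : Matrix (Fin n) (Fin m) ℝ) : Prop :=
  (Matrix.of fun (i : Fin n) (kj : Fin n × Fin m) => (A ^ (kj.1 : ℕ) * B) i kj.2).rank = n

/-- The pair `(A, C)` is observable: the matrix with block rows `C, C A, …, C A ^ (n - 1)`
has rank `n`. -/
def Observable {n p : ℕ} (A : Matrix (Fin n) (Fin n) ℝ) (C : Matrix (Fin p) (Fin n) ℝ) : Prop :=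
  (Matrix.of fun (ki : Fin n × Fin p) (j : Fin n) => (C * A ^ (ki.1 : ℕ)) ki.2 j).rank = n

/-! ### Weighted directed graphs, given by a nonnegative weight matrix `a`;
`a i j > 0` means that there is an edge from node `j` to node `i`. -/

/-- Some node has a directed path to every node. -/
def HasSpanningTree {N : ℕ} (a : Matrix (Fin N) (Fin N) ℝ) : Prop :=
  ∃ r : Fin N, ∀ i : Fin N, Relation.ReflTransGen (fun j i : Fin N => 0 < a i j) r i

/-- The Laplacian `D - a`, with `D` the diagonal matrix of in-degrees. -/
def laplacian {N : ℕ} (a : Matrix (Fin N) (Fin N) ℝ) : Matrix (Fin N) (Fin N) ℝ :=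
  Matrix.diagonal (fun i => ∑ j, a i j) - a

/-- `lam` lists the complex eigenvalues of the real matrix `L` with algebraic multiplicity,
the first one in the list being `0`. -/
def IsSpectrumList {N : ℕ} [NeZero N] (L : Matrix (Fin N) (Fin N) ℝ) (lam : Fin N → ℂ) : Prop :=
  (L.map (algebraMap ℝ ℂ)).charpoly = ∏ i, (Polynomial.X - Polynomial.C (lam i)) ∧ lam 0 = 0

/-! ### The linear quadratic regulator and its optimal Q-function -/

/-- The state at time `k` of `x (k + 1) = F x (k) + G u (k)`, `x (0) = x`. -/
def lqrState {n m : ℕ} (F : Matrix (Fin n) (Fin n) ℝ) (G : Matrix (Fin n) (Fin m) ℝ)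
    (x : Fin n → ℝ) (u : ℕ → Fin m → ℝ) : ℕ → Fin n → ℝ
  | 0 => x
  | k + 1 => F *ᵥ lqrState F G x u k + G *ᵥ u k

/-- The stage cost `xᵀ Q x + uᵀ R u`. -/
def stageCost {n m : ℕ} (Q : Matrix (Fin n) (Fin n) ℝ) (R : Matrix (Fin m) (Fin m) ℝ)
    (x : Fin n → ℝ) (u : Fin m → ℝ) : ℝ :=
  x ⬝ᵥ Q *ᵥ x + u ⬝ᵥ R *ᵥ u

/-- The finite infinite-horizon costs that can be attained from the initial state `x`. -/
def lqrCosts {n m : ℕ} (F : Matrix (Fin n) (Fin n) ℝ) (G : Matrix (Fin n) (Fin m) ℝ)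
    (Q : Matrix (Fin n) (Fin n) ℝ) (R : Matrix (Fin m) (Fin m) ℝ) (x : Fin n → ℝ) : Set ℝ :=
  {J | ∃ u : ℕ → Fin m → ℝ, HasSum (fun k => stageCost Q R (lqrState F G x u k) (u k)) J}

/-- `V` is the optimal value function of the LQR problem. -/
def IsOptimalValue {n m : ℕ} (F : Matrix (Fin n) (Fin n) ℝ) (G : Matrix (Fin n) (Fin m) ℝ)
    (Q : Matrix (Fin n) (Fin n) ℝ) (R : Matrix (Fin m) (Fin m) ℝ) (V : (Fin n → ℝ) → ℝ) : Prop :=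
  ∀ x, IsGLB (lqrCosts F G Q R x) (V x)

/-- `H` is the symmetric matrix of the optimal Q-function of the LQR problem:
`[x; u]ᵀ H [x; u] = xᵀ Q x + uᵀ R u + V (F x + G u)`, with `V` the optimal value function. -/
def IsOptimalQMatrix {n m : ℕ} (F : Matrix (Fin n) (Fin n) ℝ) (G : Matrix (Fin n) (Fin m) ℝ)
    (Q : Matrix (Fin n) (Fin n) ℝ) (R : Matrix (Fin m) (Fin m) ℝ)
    (H : Matrix (Fin n ⊕ Fin m) (Fin n ⊕ Fin m) ℝ) : Prop :=
  H.IsSymm ∧ ∃ V : (Fin n → ℝ) → ℝ, IsOptimalValue F G Q R V ∧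
    ∀ (x : Fin n → ℝ) (u : Fin m → ℝ),
      Sum.elim x u ⬝ᵥ H *ᵥ Sum.elim x u = stageCost Q R x u + V (F *ᵥ x + G *ᵥ u)

/-! ### The first semidefinite program, in the variables `H` and `W` -/

/-- The matrix `M(H, μ, A, B)`. -/
def lmiM {n m : ℕ} (A : Matrix (Fin n) (Fin n) ℝ) (B : Matrix (Fin n) (Fin m) ℝ)
    (Q : Matrix (Fin n) (Fin n) ℝ) (γ μ : ℝ) (H : Matrix (Fin n ⊕ Fin m) (Fin n ⊕ Fin m) ℝ) :
    Matrix ((Fin n ⊕ Fin m) ⊕ Fin m) ((Fin n ⊕ Fin m) ⊕ Fin m) ℝ :=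
  Matrix.fromBlocks
    (μ ^ 2 • ((Matrix.fromCols A B)ᵀ * H.toBlocks₁₁ * Matrix.fromCols A B) - H
      + Matrix.fromBlocks Q 0 0 (γ • (1 : Matrix (Fin m) (Fin m) ℝ)))
    (μ • ((Matrix.fromCols A B)ᵀ * H.toBlocks₁₂))
    (μ • (H.toBlocks₁₂ᵀ * Matrix.fromCols A B))
    H.toBlocks₂₂

/-- Feasibility of `(H, W)`. -/
def FeasibleH {n m : ℕ} (A : Matrix (Fin n) (Fin n) ℝ) (B : Matrix (Fin n) (Fin m) ℝ)
    (Q : Matrix (Fin n) (Fin n) ℝ) (γ μ : ℝ) (H : Matrix (Fin n ⊕ Fin m) (Fin n ⊕ Fin m) ℝ)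
    (W : Matrix (Fin n) (Fin n) ℝ) : Prop :=
  H.IsSymm ∧
    (Matrix.fromBlocks (H.toBlocks₁₁ - W) H.toBlocks₁₂ H.toBlocks₁₂ᵀ H.toBlocks₂₂).PosSemidef ∧
    (lmiM A B Q γ μ H).PosSemidef

/-- `(H, W)` is an optimal solution: it is feasible and maximizes `trace W`. -/
def IsSolutionH {n m : ℕ} (A : Matrix (Fin n) (Fin n) ℝ) (B : Matrix (Fin n) (Fin m) ℝ)
    (Q : Matrix (Fin n) (Fin n) ℝ) (γ μ : ℝ) (H : Matrix (Fin n ⊕ Fin m) (Fin n ⊕ Fin m) ℝ)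
    (W : Matrix (Fin n) (Fin n) ℝ) : Prop :=
  FeasibleH A B Q γ μ H W ∧
    ∀ H' W', FeasibleH A B Q γ μ H' W' → W'.trace ≤ W.trace

/-! ### The second semidefinite program, in the variables `β` and `chat` -/

/-- The matrix `N(β, chat, z)` of an eigenvalue `z`. -/
def lmiN (β chat : ℝ) (z : ℂ) : Matrix (Fin 2) (Fin 2) ℝ :=
  !![β - √(1 - z.re ^ 2 / ‖z‖ ^ 2), 1 / ‖z‖ * (chat * ‖z‖ ^ 2 - z.re);
     1 / ‖z‖ * (chat * ‖z‖ ^ 2 - z.re), β + √(1 - z.re ^ 2 / ‖z‖ ^ 2)]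

/-- Feasibility of `(β, chat)`. -/
def FeasibleBeta {n m N : ℕ} [NeZero N] (Q : Matrix (Fin n) (Fin n) ℝ)
    (H : Matrix (Fin n ⊕ Fin m) (Fin n ⊕ Fin m) ℝ) (lam : Fin N → ℂ) (β chat : ℝ) : Prop :=
  (Matrix.fromBlocks Q (β • H.toBlocks₁₂) (β • H.toBlocks₁₂ᵀ) H.toBlocks₂₂).PosSemidef ∧
    ∀ i, i ≠ 0 → (lmiN β chat (lam i)).PosSemidef

/-- `(β, chat)` is an optimal solution: it is feasible and maximizes `β`. -/
def IsSolutionBeta {n m N : ℕ} [NeZero N] (Q : Matrix (Fin n) (Fin n) ℝ)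
    (H : Matrix (Fin n ⊕ Fin m) (Fin n ⊕ Fin m) ℝ) (lam : Fin N → ℂ) (β chat : ℝ) : Prop :=
  FeasibleBeta Q H lam β chat ∧ ∀ β' chat', FeasibleBeta Q H lam β' chat' → β' ≤ β

/-! ### The distributed control law -/

/-- The feedback gain `K = H₂₂⁻¹ H₁₂ᵀ`. -/
def gainK {n m : ℕ} (H : Matrix (Fin n ⊕ Fin m) (Fin n ⊕ Fin m) ℝ) : Matrix (Fin m) (Fin n) ℝ :=
  H.toBlocks₂₂⁻¹ * H.toBlocks₁₂ᵀ

/-- The lower end of the interval of coupling gains. -/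
def c₁ {N : ℕ} [NeZero N] (lam : Fin N → ℂ) (β : ℝ) : ℝ :=
  ⨆ i : {i : Fin N // i ≠ 0},
    ((lam i).re - √((lam i).re ^ 2 - ‖lam i‖ ^ 2 * (1 - β ^ 2))) / ‖lam i‖ ^ 2

/-- The upper end of the interval of coupling gains. -/
def c₂ {N : ℕ} [NeZero N] (lam : Fin N → ℂ) (β : ℝ) : ℝ :=
  ⨅ j : {j : Fin N // j ≠ 0},
    ((lam j).re + √((lam j).re ^ 2 - ‖lam j‖ ^ 2 * (1 - β ^ 2))) / ‖lam j‖ ^ 2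

/-- The coupling gain: the midpoint of the interval. -/
def couplingGain {N : ℕ} [NeZero N] (lam : Fin N → ℂ) (β : ℝ) : ℝ := (c₁ lam β + c₂ lam β) / 2

/-- `x` (with `x k i` the state of agent `i` at time `k`) is a trajectory of the agents
`xᵢ(k+1) = A xᵢ(k) + B uᵢ(k)` under `uᵢ(k) = - c K ∑ⱼ aᵢⱼ (xᵢ(k) - xⱼ(k))`. -/
def IsClosedLoop {n m N : ℕ} (A : Matrix (Fin n) (Fin n) ℝ) (B : Matrix (Fin n) (Fin m) ℝ)
    (a : Matrix (Fin N) (Fin N) ℝ) (c : ℝ) (K : Matrix (Fin m) (Fin n) ℝ)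
    (x : ℕ → Fin N → Fin n → ℝ) : Prop :=
  ∀ k i, x (k + 1) i
    = A *ᵥ x k i + B *ᵥ (-(c • (K *ᵥ ∑ j, a i j • (x k i - x k j))))

/-- Every closed-loop trajectory reaches consensus. -/
def ReachesConsensus {n m N : ℕ} (A : Matrix (Fin n) (Fin n) ℝ) (B : Matrix (Fin n) (Fin m) ℝ)
    (a : Matrix (Fin N) (Fin N) ℝ) (c : ℝ) (K : Matrix (Fin m) (Fin n) ℝ) : Prop :=
  ∀ x : ℕ → Fin N → Fin n → ℝ, IsClosedLoop A B a c K x →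
    ∀ i j, Tendsto (fun k => ‖x k i - x k j‖) atTop (𝓝 0)

/-- The matrix `A - c z B K` of the mode of the eigenvalue `z`. -/
def modeMatrix {n m : ℕ} (A : Matrix (Fin n) (Fin n) ℝ) (B : Matrix (Fin n) (Fin m) ℝ)
    (c : ℝ) (K : Matrix (Fin m) (Fin n) ℝ) (z : ℂ) : Matrix (Fin n) (Fin n) ℂ :=
  A.map (algebraMap ℝ ℂ) - ((c : ℂ) * z) • (B * K).map (algebraMap ℝ ℂ)

end QConsensus

end

noncomputable section

namespace QConsensus

/-! ### Quadratic forms of matrices -/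

section Forms

variable {ι κ : Type*} [Fintype ι] [Fintype κ]

/-! Value iteration from zero increases, and it stays bounded because controllability steers every
state to the origin in `n` steps. Its limit `P` solves the Riccati equation and its greedy feedback
attains the optimal cost (`exists_riccati_fixedPoint`, `isOptimalValue_of_fixedPoint`), so the
matrix `H` is `qMatrix`. Both constraints of the first SDP are Bellman inequalities. Summed along
the stable greedy trajectory they give `xᵀ W x ≤ xᵀ P x` for every feasible `W`
(`FeasibleH.quad_le`), which makes `P` optimal.

Put `F = μA`, `G = μB`, `S = H₂₂`. The constraints of the second SDP say that `β² Kᵀ S K ≤ Q` and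
`|1 - ĉ λᵢ| ≤ β` (`feasibleBeta_iff`). If `v` is an eigenvector of `F - z G K` with eigenvalue `s`
and `w = K v`, the Riccati equation gives `|s|² v*Pv = v*Pv - v*Qv + |1 - z|² w*Sw - γ |z|² |w|²`
(`hermForm_eigenvector`). If `|1 - z| ≤ β`, the right side is at most `v*Pv`, so `|s| ≥ 1` forces
equality throughout. Provided `z ≠ 0` or `β > 1`, this yields `z w = 0` and `v*Qv = 0`, so `v` is an
unobservable eigenvector of `A`, a contradiction (`eigenvalue_norm_lt_one`). The choice `z = c λᵢ`
gives the rate; `z = 1`, `β = 0` gives stability of the greedy loop.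

Each condition `|1 - c λᵢ| ≤ β` confines `c` to an interval. The intervals share `ĉ`, so the
midpoint of their intersection is admissible (`couplingGain_mem`). The spanning tree and
Gershgorin's theorem give `Re λᵢ > 0`, hence `c > 0` when `β ≤ 1`.

For consensus, the state space splits along the generalized eigenspaces of the Laplacian. At a
nonzero eigenvalue the mode matrix is driven by the next lower level of the Jordan filtration, so
induction gives decay (`summable_closedLoop`). At zero the generalized eigenspace contains only
constants, which are consensus states. -/

theorem mulVec_dotProduct_eq (A : Matrix ι κ ℝ) (x : κ → ℝ) (y : ι → ℝ) :
    (A *ᵥ x) ⬝ᵥ y = x ⬝ᵥ Aᵀ *ᵥ y := by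
  rw [dotProduct_mulVec, vecMul_transpose]

theorem posSemidef_iff_isSymm {M : Matrix ι ι ℝ} :
    M.PosSemidef ↔ M.IsSymm ∧ ∀ x : ι → ℝ, 0 ≤ x ⬝ᵥ M *ᵥ x := by
  rw [posSemidef_iff_dotProduct_mulVec]
  simp [IsHermitian, IsSymm]

theorem quad_nonneg {M : Matrix ι ι ℝ} (h : M.PosSemidef) (x : ι → ℝ) : 0 ≤ x ⬝ᵥ M *ᵥ x :=
  (posSemidef_iff_isSymm.1 h).2 x

theorem isSymm_of_posSemidef {M : Matrix ι ι ℝ} (h : M.PosSemidef) : M.IsSymm :=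
  (posSemidef_iff_isSymm.1 h).1

theorem dotProduct_mulVec_symm {M : Matrix ι ι ℝ} (h : M.IsSymm) (x y : ι → ℝ) :
    x ⬝ᵥ M *ᵥ y = y ⬝ᵥ M *ᵥ x := by
  rw [dotProduct_comm, mulVec_dotProduct_eq, h.eq]

/-- Polarization: the entries of a symmetric matrix in terms of its quadratic form. -/
theorem entry_eq_quad [DecidableEq ι] {M : Matrix ι ι ℝ} (h : M.IsSymm) (i j : ι) :
    M i j = ((Pi.single i 1 + Pi.single j 1) ⬝ᵥ M *ᵥ (Pi.single i 1 + Pi.single j 1)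
      - Pi.single i 1 ⬝ᵥ M *ᵥ Pi.single i 1 - Pi.single j 1 ⬝ᵥ M *ᵥ Pi.single j 1) / 2 := by
  have hs := h.apply i j
  simp [mulVec_add, add_dotProduct, dotProduct_add]
  rw [hs]; ring

theorem eq_of_quad_eq {M M' : Matrix ι ι ℝ} (h : M.IsSymm) (h' : M'.IsSymm)
    (he : ∀ x : ι → ℝ, x ⬝ᵥ M *ᵥ x = x ⬝ᵥ M' *ᵥ x) : M = M' := by
  classical
  ext i j
  rw [entry_eq_quad h, entry_eq_quad h', he, he, he]

end Forms

/-! ### The Riccati operator -/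

section Riccati

variable {n m : ℕ}

/-- The Hessian `R + Gᵀ P G` of the Bellman right-hand side in the input. -/
def inputHessian (G : Matrix (Fin n) (Fin m) ℝ) (R : Matrix (Fin m) (Fin m) ℝ)
    (P : Matrix (Fin n) (Fin n) ℝ) : Matrix (Fin m) (Fin m) ℝ := R + Gᵀ * P * G

/-- The feedback gain that is greedy with respect to the value function `xᵀ P x`. -/
def greedyGain (F : Matrix (Fin n) (Fin n) ℝ) (G : Matrix (Fin n) (Fin m) ℝ)
    (R : Matrix (Fin m) (Fin m) ℝ) (P : Matrix (Fin n) (Fin n) ℝ) : Matrix (Fin m) (Fin n) ℝ :=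
  (inputHessian G R P)⁻¹ * (Gᵀ * P * F)

/-- The Riccati operator. -/
def riccati (F : Matrix (Fin n) (Fin n) ℝ) (G : Matrix (Fin n) (Fin m) ℝ)
    (Q : Matrix (Fin n) (Fin n) ℝ) (R : Matrix (Fin m) (Fin m) ℝ)
    (P : Matrix (Fin n) (Fin n) ℝ) : Matrix (Fin n) (Fin n) ℝ :=
  Q + Fᵀ * P * F - (greedyGain F G R P)ᵀ * inputHessian G R P * greedyGain F G R P

variable (F : Matrix (Fin n) (Fin n) ℝ) (G : Matrix (Fin n) (Fin m) ℝ)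
  {Q : Matrix (Fin n) (Fin n) ℝ} {R : Matrix (Fin m) (Fin m) ℝ} {P : Matrix (Fin n) (Fin n) ℝ}

theorem inputHessian_posDef (hR : R.PosDef) (hP : P.PosSemidef) :
    (inputHessian G R P).PosDef := by
  have := hP.conjTranspose_mul_mul_same G
  rw [conjTranspose_eq_transpose_of_trivial] at this
  exact hR.add_posSemidef this

theorem inputHessian_mul_greedyGain (hR : R.PosDef) (hP : P.PosSemidef) :
    inputHessian G R P * greedyGain F G R P = Gᵀ * P * F := by
  rw [greedyGain, ← Matrix.mul_assoc, mul_nonsing_inv _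
    ((isUnit_iff_isUnit_det _).1 (inputHessian_posDef G hR hP).isUnit), Matrix.one_mul]

/-- Completion of squares in the Bellman equation. -/
theorem stageCost_add_quad (hR : R.PosDef) (hP : P.PosSemidef) (x : Fin n → ℝ) (u : Fin m → ℝ) :
    stageCost Q R x u + (F *ᵥ x + G *ᵥ u) ⬝ᵥ P *ᵥ (F *ᵥ x + G *ᵥ u) =
      x ⬝ᵥ riccati F G Q R P *ᵥ x + (u + greedyGain F G R P *ᵥ x) ⬝ᵥ
        inputHessian G R P *ᵥ (u + greedyGain F G R P *ᵥ x) := by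
  have hS := isSymm_of_posSemidef (inputHessian_posDef G hR hP).posSemidef
  have hSK := inputHessian_mul_greedyGain F G hR hP
  have hPs := isSymm_of_posSemidef hP
  set K := greedyGain F G R P
  have h1 : u ⬝ᵥ inputHessian G R P *ᵥ (K *ᵥ x) = (G *ᵥ u) ⬝ᵥ P *ᵥ (F *ᵥ x) := by
    rw [mulVec_mulVec, hSK, mulVec_dotProduct_eq]
    simp [mulVec_mulVec, Matrix.mul_assoc]
  have h2 : u ⬝ᵥ inputHessian G R P *ᵥ u = u ⬝ᵥ R *ᵥ u + (G *ᵥ u) ⬝ᵥ P *ᵥ (G *ᵥ u) := by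
    rw [mulVec_dotProduct_eq]
    simp [inputHessian, mulVec_mulVec, Matrix.mul_assoc, add_mulVec, dotProduct_add]
  have h3 : x ⬝ᵥ riccati F G Q R P *ᵥ x = x ⬝ᵥ Q *ᵥ x + (F *ᵥ x) ⬝ᵥ P *ᵥ (F *ᵥ x)
      - (K *ᵥ x) ⬝ᵥ inputHessian G R P *ᵥ (K *ᵥ x) := by
    rw [mulVec_dotProduct_eq, mulVec_dotProduct_eq]
    simp [riccati, mulVec_mulVec, Matrix.mul_assoc, add_mulVec, sub_mulVec, dotProduct_add,
      dotProduct_sub, K]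
  simp only [stageCost, mulVec_add, add_dotProduct, dotProduct_add]
  rw [h3, h1, h2, dotProduct_mulVec_symm hS (K *ᵥ x) u, h1,
    dotProduct_mulVec_symm hPs (F *ᵥ x) (G *ᵥ u)]
  ring

theorem riccati_quad_eq (hR : R.PosDef) (hP : P.PosSemidef) (x : Fin n → ℝ) :
    x ⬝ᵥ riccati F G Q R P *ᵥ x = stageCost Q R x (-(greedyGain F G R P *ᵥ x)) +
      (F *ᵥ x + G *ᵥ (-(greedyGain F G R P *ᵥ x))) ⬝ᵥ P *ᵥ
        (F *ᵥ x + G *ᵥ (-(greedyGain F G R P *ᵥ x))) := by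
  rw [stageCost_add_quad F G hR hP]; simp

theorem riccati_quad_le (hR : R.PosDef) (hP : P.PosSemidef) (x : Fin n → ℝ) (u : Fin m → ℝ) :
    x ⬝ᵥ riccati F G Q R P *ᵥ x ≤
      stageCost Q R x u + (F *ᵥ x + G *ᵥ u) ⬝ᵥ P *ᵥ (F *ᵥ x + G *ᵥ u) := by
  rw [stageCost_add_quad F G hR hP]
  have := quad_nonneg (inputHessian_posDef G hR hP).posSemidef (u + greedyGain F G R P *ᵥ x)
  linarith

theorem stageCost_nonneg (hQ : Q.PosSemidef) (hR : R.PosDef) (x : Fin n → ℝ) (u : Fin m → ℝ) :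
    0 ≤ stageCost Q R x u :=
  add_nonneg (quad_nonneg hQ x) (quad_nonneg hR.posSemidef u)

theorem riccati_posSemidef (hQ : Q.PosSemidef) (hR : R.PosDef) (hP : P.PosSemidef) :
    (riccati F G Q R P).PosSemidef := by
  refine posSemidef_iff_isSymm.2 ⟨?_, fun x => ?_⟩
  · have hS := isSymm_of_posSemidef (inputHessian_posDef G hR hP).posSemidef
    simp only [IsSymm, riccati, transpose_sub, transpose_add, transpose_mul, transpose_transpose,
      (isSymm_of_posSemidef hQ).eq, (isSymm_of_posSemidef hP).eq, hS.eq, Matrix.mul_assoc]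
  · rw [riccati_quad_eq F G hR hP]
    exact add_nonneg (stageCost_nonneg hQ hR _ _) (quad_nonneg hP _)

/-- The greedy input for `P'` is an admissible competitor in the minimization that defines the
Riccati operator at `P`. -/
theorem riccati_mono {P' : Matrix (Fin n) (Fin n) ℝ} (hR : R.PosDef) (hP : P.PosSemidef)
    (hP' : P'.PosSemidef) (h : ∀ x, x ⬝ᵥ P *ᵥ x ≤ x ⬝ᵥ P' *ᵥ x) (x : Fin n → ℝ) :
    x ⬝ᵥ riccati F G Q R P *ᵥ x ≤ x ⬝ᵥ riccati F G Q R P' *ᵥ x := by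
  rw [riccati_quad_eq F G hR hP']
  exact (riccati_quad_le F G hR hP x _).trans (by gcongr; exact h _)

/-- Value iteration. -/
def valueIter (Q : Matrix (Fin n) (Fin n) ℝ) (R : Matrix (Fin m) (Fin m) ℝ) :
    ℕ → Matrix (Fin n) (Fin n) ℝ
  | 0 => 0
  | k + 1 => riccati F G Q R (valueIter Q R k)

theorem valueIter_posSemidef (hQ : Q.PosSemidef) (hR : R.PosDef) (k : ℕ) :
    (valueIter F G Q R k).PosSemidef := by
  induction k with
  | zero => exact PosSemidef.zero
  | succ k ih => exact riccati_posSemidef F G hQ hR ih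

theorem valueIter_monotone (hQ : Q.PosSemidef) (hR : R.PosDef) (x : Fin n → ℝ) :
    Monotone fun k => x ⬝ᵥ valueIter F G Q R k *ᵥ x := by
  refine monotone_nat_of_le_succ fun k => ?_
  induction k generalizing x with
  | zero => simpa [valueIter] using quad_nonneg (valueIter_posSemidef F G hQ hR 1) x
  | succ k ih =>
    exact riccati_mono F G hR (valueIter_posSemidef F G hQ hR k)
      (valueIter_posSemidef F G hQ hR (k + 1)) ih x

theorem lqrState_succ' (x : Fin n → ℝ) (u : ℕ → Fin m → ℝ) (k : ℕ) :
    lqrState F G x u (k + 1) = lqrState F G (F *ᵥ x + G *ᵥ u 0) (fun j => u (j + 1)) k := by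
  induction k with
  | zero => rfl
  | succ k ih => rw [lqrState, ih]; rfl

/-- Dynamic programming: the iterate is the optimal `k`-step cost with zero terminal cost. The
induction peels off the first input, which is why `lqrState_succ'` is needed. -/
theorem valueIter_le_sum (hQ : Q.PosSemidef) (hR : R.PosDef) (k : ℕ) (x : Fin n → ℝ)
    (u : ℕ → Fin m → ℝ) :
    x ⬝ᵥ valueIter F G Q R k *ᵥ x ≤
      ∑ j ∈ Finset.range k, stageCost Q R (lqrState F G x u j) (u j) := by
  induction k generalizing x u with
  | zero => simp [valueIter]
  | succ k ih =>
    rw [Finset.sum_range_succ']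
    simp only [lqrState_succ']
    have h1 := riccati_quad_le (Q := Q) F G hR (valueIter_posSemidef F G hQ hR k) x (u 0)
    have h2 := ih (F *ᵥ x + G *ᵥ u 0) (fun j => u (j + 1))
    simp only [lqrState, valueIter] at *
    linarith

theorem tendsto_riccati {Ps : ℕ → Matrix (Fin n) (Fin n) ℝ} {l : Filter ℕ}
    (hR : R.PosDef) (hP : P.PosSemidef) (h : Tendsto Ps l (𝓝 P)) :
    Tendsto (fun k => riccati F G Q R (Ps k)) l (𝓝 (riccati F G Q R P)) := by
  have hS : Continuous fun P : Matrix (Fin n) (Fin n) ℝ => inputHessian G R P := by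
    unfold inputHessian; fun_prop
  have hdet : (inputHessian G R P).det ≠ 0 :=
    ((isUnit_iff_isUnit_det _).1 (inputHessian_posDef G hR hP).isUnit).ne_zero
  have hinv : ContinuousAt (fun P : Matrix (Fin n) (Fin n) ℝ => (inputHessian G R P)⁻¹) P := by
    simp only [Matrix.inv_def, Ring.inverse_eq_inv']
    exact (hS.matrix_det.continuousAt.inv₀ hdet).smul hS.matrix_adjugate.continuousAt
  -- With the inverse as an independent second argument the operator is polynomial, so only
  -- continuity of inversion at the nonsingular Hessian is needed.
  let φ : Matrix (Fin n) (Fin n) ℝ × Matrix (Fin m) (Fin m) ℝ → Matrix (Fin n) (Fin n) ℝ :=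
    fun z => Q + Fᵀ * z.1 * F - (z.2 * (Gᵀ * z.1 * F))ᵀ * (R + Gᵀ * z.1 * G) *
        (z.2 * (Gᵀ * z.1 * F))
  have hc : Continuous φ := by fun_prop
  have hi : Tendsto (fun k => (inputHessian G R (Ps k))⁻¹) l (𝓝 (inputHessian G R P)⁻¹) :=
    hinv.tendsto.comp h
  have hφ : ∀ P, riccati F G Q R P = φ (P, (inputHessian G R P)⁻¹) := fun P => rfl
  simp only [hφ]
  exact (hc.tendsto _).comp (h.prodMk_nhds hi)

/-- If every state has a finite cost, value iteration converges to a fixed point of the Riccati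
operator, which bounds all costs from below. -/
theorem exists_riccati_fixedPoint (hQ : Q.PosSemidef) (hR : R.PosDef)
    (hfin : ∀ x, (lqrCosts F G Q R x).Nonempty) :
    ∃ P : Matrix (Fin n) (Fin n) ℝ, P.PosSemidef ∧ riccati F G Q R P = P ∧
      ∀ x, ∀ J ∈ lqrCosts F G Q R x, x ⬝ᵥ P *ᵥ x ≤ J := by
  have hle : ∀ x, ∀ J ∈ lqrCosts F G Q R x, ∀ k, x ⬝ᵥ valueIter F G Q R k *ᵥ x ≤ J := by
    rintro x J ⟨u, hu⟩ k
    exact (valueIter_le_sum F G hQ hR k x u).trans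
      (sum_le_hasSum _ (fun j _ => stageCost_nonneg hQ hR _ _) hu)
  have hlim : ∀ x, ∃ l, Tendsto (fun k => x ⬝ᵥ valueIter F G Q R k *ᵥ x) atTop (𝓝 l) := by
    intro x
    obtain ⟨J, hJ⟩ := hfin x
    exact ⟨_, tendsto_atTop_ciSup (valueIter_monotone F G hQ hR x)
      ⟨J, by rintro _ ⟨k, rfl⟩; exact hle x J hJ k⟩⟩
  choose l hl using hlim
  -- The quadratic forms converge pointwise; polarization turns this into convergence of the
  -- entries.
  let P : Matrix (Fin n) (Fin n) ℝ := Matrix.of fun i j =>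
    (l (Pi.single i 1 + Pi.single j 1) - l (Pi.single i 1) - l (Pi.single j 1)) / 2
  have hP : Tendsto (valueIter F G Q R) atTop (𝓝 P) := by
    refine tendsto_pi_nhds.2 fun i => tendsto_pi_nhds.2 fun j => ?_
    refine Tendsto.congr (fun k => (entry_eq_quad
      (isSymm_of_posSemidef (valueIter_posSemidef F G hQ hR k)) i j).symm) ?_
    exact (((hl _).sub (hl _)).sub (hl _)).div_const 2
  have hPl : ∀ x, x ⬝ᵥ P *ᵥ x = l x := by
    intro x
    have hc : Continuous fun M : Matrix (Fin n) (Fin n) ℝ => x ⬝ᵥ M *ᵥ x :=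
      continuous_const.dotProduct (continuous_id.matrix_mulVec continuous_const)
    exact tendsto_nhds_unique ((hc.tendsto P).comp hP) (hl x)
  have hPs : P.PosSemidef := by
    refine posSemidef_iff_isSymm.2 ⟨?_, fun x => ?_⟩
    · ext i j
      simp only [P, transpose_apply, of_apply]
      rw [add_comm]; ring
    · rw [hPl]
      exact ge_of_tendsto' (hl x) fun k => quad_nonneg (valueIter_posSemidef F G hQ hR k) x
  refine ⟨P, hPs, tendsto_nhds_unique (tendsto_riccati F G hR hPs hP)
    ((tendsto_add_atTop_iff_nat 1).2 hP), fun x J hJ => ?_⟩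
  rw [hPl]
  exact le_of_tendsto' (hl x) (hle x J hJ)

/-- The closed-loop matrix of the greedy policy. -/
def greedyLoop (R : Matrix (Fin m) (Fin m) ℝ) (P : Matrix (Fin n) (Fin n) ℝ) :
    Matrix (Fin n) (Fin n) ℝ := F - G * greedyGain F G R P

theorem mulVec_add_greedy (x : Fin n → ℝ) :
    F *ᵥ x + G *ᵥ (-(greedyGain F G R P *ᵥ x)) = greedyLoop F G R P *ᵥ x := by
  rw [greedyLoop, sub_mulVec, mulVec_neg, mulVec_mulVec, sub_eq_add_neg]

theorem lqrState_greedy (x : Fin n → ℝ) (k : ℕ) :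
    lqrState F G x (fun k => -(greedyGain F G R P *ᵥ (greedyLoop F G R P ^ k *ᵥ x))) k =
      greedyLoop F G R P ^ k *ᵥ x := by
  induction k with
  | zero => simp [lqrState]
  | succ k ih => rw [lqrState, ih, mulVec_add_greedy, mulVec_mulVec, pow_succ']

/-- The Bellman equation holds with equality along the greedy policy, so the sum telescopes. -/
theorem sum_stageCost_greedy (hR : R.PosDef) (hP : P.PosSemidef) (hfix : riccati F G Q R P = P)
    (x : Fin n → ℝ) (T : ℕ) :
    ∑ j ∈ Finset.range T, stageCost Q R (greedyLoop F G R P ^ j *ᵥ x)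
        (-(greedyGain F G R P *ᵥ (greedyLoop F G R P ^ j *ᵥ x))) =
      x ⬝ᵥ P *ᵥ x - (greedyLoop F G R P ^ T *ᵥ x) ⬝ᵥ P *ᵥ (greedyLoop F G R P ^ T *ᵥ x) := by
  induction T with
  | zero => simp
  | succ T ih =>
    have h := riccati_quad_eq (Q := Q) F G hR hP (greedyLoop F G R P ^ T *ᵥ x)
    rw [hfix, mulVec_add_greedy, mulVec_mulVec x (greedyLoop F G R P), ← pow_succ'] at h
    rw [Finset.sum_range_succ, ih]
    linarith

/-- A fixed point of the Riccati operator that bounds all costs from below is the matrix of the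
optimal value function. -/
theorem isOptimalValue_of_fixedPoint (hQ : Q.PosSemidef) (hR : R.PosDef) (hP : P.PosSemidef)
    (hfix : riccati F G Q R P = P)
    (hle : ∀ x, ∀ J ∈ lqrCosts F G Q R x, x ⬝ᵥ P *ᵥ x ≤ J) :
    IsOptimalValue F G Q R fun x => x ⬝ᵥ P *ᵥ x := by
  refine fun x => IsLeast.isGLB ⟨?_, fun J hJ => hle x J hJ⟩
  let u : ℕ → Fin m → ℝ := fun k => -(greedyGain F G R P *ᵥ (greedyLoop F G R P ^ k *ᵥ x))
  let f : ℕ → ℝ := fun k => stageCost Q R (lqrState F G x u k) (u k)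
  have hf0 : ∀ k, 0 ≤ f k := fun k => stageCost_nonneg hQ hR _ _
  have hsum : ∀ T, ∑ j ∈ Finset.range T, f j ≤ x ⬝ᵥ P *ᵥ x := by
    intro T
    have := sum_stageCost_greedy F G hR hP hfix x T
    simp only [f, u, lqrState_greedy]
    rw [this]
    linarith [quad_nonneg hP (greedyLoop F G R P ^ T *ᵥ x)]
  have hs : Summable f := summable_of_sum_range_le hf0 hsum
  have h1 : ∑' k, f k ≤ x ⬝ᵥ P *ᵥ x := Real.tsum_le_of_sum_range_le hf0 hsum
  -- The terminal term need not be shown to vanish: the lower bound on all costs already forces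
  -- equality.
  have h2 := hle x _ ⟨u, hs.hasSum⟩
  refine ⟨u, ?_⟩
  show HasSum f (x ⬝ᵥ P *ᵥ x)
  rw [le_antisymm h2 h1]
  exact hs.hasSum

/-- The matrix of the Q-function that belongs to the value function `xᵀ P x`. -/
def qMatrix (Q : Matrix (Fin n) (Fin n) ℝ) (R : Matrix (Fin m) (Fin m) ℝ)
    (P : Matrix (Fin n) (Fin n) ℝ) : Matrix (Fin n ⊕ Fin m) (Fin n ⊕ Fin m) ℝ :=
  fromBlocks (Q + Fᵀ * P * F) (Fᵀ * P * G) (Gᵀ * P * F) (inputHessian G R P)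

theorem qMatrix_isSymm (hQ : Q.PosSemidef) (hR : R.PosDef) (hP : P.PosSemidef) :
    (qMatrix F G Q R P).IsSymm := by
  simp only [qMatrix, IsSymm, fromBlocks_transpose, transpose_add, transpose_mul,
    transpose_transpose, (isSymm_of_posSemidef hQ).eq, (isSymm_of_posSemidef hP).eq,
    (isSymm_of_posSemidef (inputHessian_posDef G hR hP).posSemidef).eq, Matrix.mul_assoc]

theorem sumElim_dotProduct_fromBlocks {ι κ : Type*} [Fintype ι] [Fintype κ]
    (M₁ : Matrix ι ι ℝ) (M₂ : Matrix ι κ ℝ) (M₃ : Matrix κ ι ℝ) (M₄ : Matrix κ κ ℝ)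
    (x : ι → ℝ) (u : κ → ℝ) :
    Sum.elim x u ⬝ᵥ fromBlocks M₁ M₂ M₃ M₄ *ᵥ Sum.elim x u =
      x ⬝ᵥ M₁ *ᵥ x + x ⬝ᵥ M₂ *ᵥ u + u ⬝ᵥ M₃ *ᵥ x + u ⬝ᵥ M₄ *ᵥ u := by
  rw [fromBlocks_mulVec, sumElim_dotProduct_sumElim]
  simp only [Sum.elim_comp_inl, Sum.elim_comp_inr, dotProduct_add]
  ring

theorem qMatrix_quad (x : Fin n → ℝ) (u : Fin m → ℝ) :
    Sum.elim x u ⬝ᵥ qMatrix F G Q R P *ᵥ Sum.elim x u =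
      stageCost Q R x u + (F *ᵥ x + G *ᵥ u) ⬝ᵥ P *ᵥ (F *ᵥ x + G *ᵥ u) := by
  rw [qMatrix, sumElim_dotProduct_fromBlocks, stageCost]
  simp only [inputHessian, add_mulVec, dotProduct_add, add_dotProduct, mulVec_add,
    mulVec_dotProduct_eq, mulVec_mulVec, Matrix.mul_assoc]
  ring

theorem isOptimalQMatrix_qMatrix (hQ : Q.PosSemidef) (hR : R.PosDef) (hP : P.PosSemidef)
    (hfix : riccati F G Q R P = P)
    (hle : ∀ x, ∀ J ∈ lqrCosts F G Q R x, x ⬝ᵥ P *ᵥ x ≤ J) :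
    IsOptimalQMatrix F G Q R (qMatrix F G Q R P) :=
  ⟨qMatrix_isSymm F G hQ hR hP, _, isOptimalValue_of_fixedPoint F G hQ hR hP hfix hle,
    qMatrix_quad F G⟩

variable {F G}

/-- Greatest lower bounds are unique, so the value functions agree, and a symmetric matrix is
determined by its quadratic form. -/
theorem IsOptimalQMatrix.unique {H H' : Matrix (Fin n ⊕ Fin m) (Fin n ⊕ Fin m) ℝ}
    (h : IsOptimalQMatrix F G Q R H) (h' : IsOptimalQMatrix F G Q R H') : H = H' := by
  obtain ⟨hs, V, hV, he⟩ := h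
  obtain ⟨hs', V', hV', he'⟩ := h'
  obtain rfl : V = V' := funext fun x => (hV x).unique (hV' x)
  refine eq_of_quad_eq hs hs' fun z => ?_
  rw [← Sum.elim_comp_inl_inr z, he, he']

end Riccati

/-! ### Controllability and observability -/

section Systems

variable {n m p : ℕ}

theorem lqrState_eq (F : Matrix (Fin n) (Fin n) ℝ) (G : Matrix (Fin n) (Fin m) ℝ)
    (x : Fin n → ℝ) (u : ℕ → Fin m → ℝ) (k : ℕ) :
    lqrState F G x u k = F ^ k *ᵥ x +
      ∑ j ∈ Finset.range k, (F ^ j * G) *ᵥ u (k - 1 - j) := by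
  induction k with
  | zero => simp [lqrState]
  | succ k ih =>
    rw [lqrState, ih, Finset.sum_range_succ', mulVec_add, mulVec_mulVec, ← pow_succ',
      mulVec_sum, add_assoc]
    congr 2
    · refine Finset.sum_congr rfl fun j hj => ?_
      rw [mulVec_mulVec, ← Matrix.mul_assoc, ← pow_succ']
      congr 2; omega
    · simp

theorem Controllable.exists_sum_eq {A : Matrix (Fin n) (Fin n) ℝ} {B : Matrix (Fin n) (Fin m) ℝ}
    (h : Controllable A B) (y : Fin n → ℝ) :
    ∃ w : Fin n → Fin m → ℝ, ∑ k : Fin n, (A ^ (k : ℕ) * B) *ᵥ w k = y := by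
  rw [Controllable, rank] at h
  have htop := Submodule.eq_top_of_finrank_eq (h.trans (Module.finrank_fin_fun ℝ).symm)
  obtain ⟨w, hw⟩ := LinearMap.range_eq_top.1 htop y
  refine ⟨fun k j => w (k, j), ?_⟩
  rw [← hw]
  ext i
  simp [mulVec, dotProduct, Fintype.sum_prod_type]

/-- From every state of a controllable system there is a control of finite cost. -/
theorem Controllable.lqrCosts_nonempty {A : Matrix (Fin n) (Fin n) ℝ}
    {B : Matrix (Fin n) (Fin m) ℝ} (h : Controllable A B) {μ : ℝ} (hμ : μ ≠ 0)
    (Q : Matrix (Fin n) (Fin n) ℝ) (R : Matrix (Fin m) (Fin m) ℝ) (x : Fin n → ℝ) :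
    (lqrCosts (μ • A) (μ • B) Q R x).Nonempty := by
  obtain ⟨w, hw⟩ := h.exists_sum_eq (-((μ • A) ^ n *ᵥ x))
  -- Deadbeat control: the weights `w` appear in reversed time, and the factor cancels the `μ ^ (j +
  -- 1)` in `(μA)^j (μB)`.
  let u : ℕ → Fin m → ℝ := fun k =>
    if hk : n - 1 - k < n ∧ k < n then (μ ^ (n - 1 - k + 1))⁻¹ • w ⟨n - 1 - k, hk.1⟩ else 0
  have hu : ∀ k, n ≤ k → u k = 0 := fun k hk => dif_neg (by omega)
  have hn : lqrState (μ • A) (μ • B) x u n = 0 := by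
    rw [lqrState_eq, ← Fin.sum_univ_eq_sum_range
      (fun j => ((μ • A) ^ j * (μ • B)) *ᵥ u (n - 1 - j))]
    have : ∀ j : Fin n, ((μ • A) ^ (j : ℕ) * (μ • B)) *ᵥ u (n - 1 - j)
        = (A ^ (j : ℕ) * B) *ᵥ w j := by
      intro j
      have hj := j.2
      have e : n - 1 - (n - 1 - (j : ℕ)) = j := by omega
      simp only [u]
      rw [dif_pos (by omega)]
      simp only [e, Fin.eta, smul_pow, Matrix.smul_mul, Matrix.mul_smul, smul_mulVec, mulVec_smul,
        smul_smul]
      rw [pow_succ, mul_comm μ, inv_mul_cancel₀ (mul_ne_zero (pow_ne_zero _ hμ) hμ), one_smul]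
    rw [Finset.sum_congr rfl fun j _ => this j, hw, add_neg_cancel]
  have hz : ∀ k, lqrState (μ • A) (μ • B) x u (n + k) = 0 := by
    intro k
    induction k with
    | zero => exact hn
    | succ k ih => rw [← add_assoc, lqrState, ih, hu _ (by omega)]; simp
  refine ⟨_, u, (summable_of_ne_finset_zero (s := Finset.range n) fun k hk => ?_).hasSum⟩
  obtain ⟨j, rfl⟩ := Nat.exists_eq_add_of_le (not_lt.1 (Finset.mem_range.not.1 hk))
  rw [hz, hu _ (by omega)]
  simp [stageCost]

theorem Observable.eq_zero {A : Matrix (Fin n) (Fin n) ℝ} {C : Matrix (Fin p) (Fin n) ℝ}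
    (h : Observable A C) {x : Fin n → ℝ} (hx : ∀ k, (C * A ^ k) *ᵥ x = 0) : x = 0 := by
  rw [Observable, rank] at h
  set O : Matrix (Fin n × Fin p) (Fin n) ℝ :=
    Matrix.of fun (ki : Fin n × Fin p) (j : Fin n) => (C * A ^ (ki.1 : ℕ)) ki.2 j
  have hk := O.mulVecLin.finrank_range_add_finrank_ker
  rw [h, Module.finrank_fin_fun, Nat.add_eq_left, Submodule.finrank_eq_zero] at hk
  refine (Submodule.eq_bot_iff _).1 hk x ?_
  rw [LinearMap.mem_ker]
  ext ki
  exact congrFun (hx ki.1) ki.2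

/-- An unobservable complex eigenvector is zero. -/
theorem Observable.eigenvector_eq_zero {A : Matrix (Fin n) (Fin n) ℝ}
    {C : Matrix (Fin p) (Fin n) ℝ} (h : Observable A C) {v : Fin n → ℂ} {s : ℂ}
    (hv : A.map (algebraMap ℝ ℂ) *ᵥ v = s • v) (hC : C.map (algebraMap ℝ ℂ) *ᵥ v = 0) :
    v = 0 := by
  have hpow : ∀ k, (C * A ^ k).map (algebraMap ℝ ℂ) *ᵥ v = 0 := by
    intro k
    have : (A.map (algebraMap ℝ ℂ)) ^ k *ᵥ v = s ^ k • v := by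
      induction k with
      | zero => simp
      | succ k ih => rw [pow_succ', ← mulVec_mulVec, ih, mulVec_smul, hv, smul_smul, pow_succ]
    rw [Matrix.map_mul, Matrix.map_pow, ← mulVec_mulVec, this, mulVec_smul, hC, smul_zero]
  -- The matrices are real, so the real and imaginary parts of `v` are separately unobservable.
  have hre : (fun i => (v i).re) = 0 := h.eq_zero fun k => by
    ext i
    simpa [mulVec, dotProduct] using congrArg Complex.re (congrFun (hpow k) i)
  have him : (fun i => (v i).im) = 0 := h.eq_zero fun k => by
    ext i
    simpa [mulVec, dotProduct] using congrArg Complex.im (congrFun (hpow k) i)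
  ext i
  exact Complex.ext (congrFun hre i) (congrFun him i)

end Systems

/-! ### The first semidefinite program -/

section FirstSDP

variable {n m : ℕ} {A : Matrix (Fin n) (Fin n) ℝ} {B : Matrix (Fin n) (Fin m) ℝ}
  {Q : Matrix (Fin n) (Fin n) ℝ} {γ μ : ℝ} {H : Matrix (Fin n ⊕ Fin m) (Fin n ⊕ Fin m) ℝ}
  {W : Matrix (Fin n) (Fin n) ℝ}

theorem toBlocks₂₁_eq (hH : H.IsSymm) : H.toBlocks₂₁ = H.toBlocks₁₂ᵀ := by
  ext i j
  exact hH.apply _ _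

theorem toBlocks₁₁_isSymm (hH : H.IsSymm) : H.toBlocks₁₁.IsSymm := by
  ext i j
  exact hH.apply _ _

theorem toBlocks₂₂_isSymm (hH : H.IsSymm) : H.toBlocks₂₂.IsSymm := by
  ext i j
  exact hH.apply _ _

theorem quad_eq_blocks (hH : H.IsSymm) (x : Fin n → ℝ) (u : Fin m → ℝ) :
    Sum.elim x u ⬝ᵥ H *ᵥ Sum.elim x u = x ⬝ᵥ H.toBlocks₁₁ *ᵥ x + x ⬝ᵥ H.toBlocks₁₂ *ᵥ u
      + u ⬝ᵥ H.toBlocks₁₂ᵀ *ᵥ x + u ⬝ᵥ H.toBlocks₂₂ *ᵥ u := by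
  conv_lhs => rw [← fromBlocks_toBlocks H, sumElim_dotProduct_fromBlocks, toBlocks₂₁_eq hH]

/-- The quadratic form of the matrix `M(H, μ, A, B)`. -/
theorem lmiM_quad (hH : H.IsSymm) (x : Fin n → ℝ) (u v : Fin m → ℝ) :
    Sum.elim (Sum.elim x u) v ⬝ᵥ lmiM A B Q γ μ H *ᵥ Sum.elim (Sum.elim x u) v =
      Sum.elim ((μ • A) *ᵥ x + (μ • B) *ᵥ u) v ⬝ᵥ H *ᵥ
          Sum.elim ((μ • A) *ᵥ x + (μ • B) *ᵥ u) v
        - Sum.elim x u ⬝ᵥ H *ᵥ Sum.elim x u + stageCost Q (γ • 1) x u := by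
  have hD : ∀ y : Fin n → ℝ, Sum.elim x u ⬝ᵥ (fromCols A B)ᵀ *ᵥ y = (A *ᵥ x + B *ᵥ u) ⬝ᵥ y := by
    intro y
    rw [← mulVec_dotProduct_eq]; simp
  rw [lmiM, sumElim_dotProduct_fromBlocks, quad_eq_blocks hH]
  simp only [add_mulVec, sub_mulVec, smul_mulVec, dotProduct_add, dotProduct_sub, dotProduct_smul,
    ← mulVec_mulVec, Matrix.mul_assoc, hD, sumElim_dotProduct_fromBlocks, fromCols_mulVec,
    Sum.elim_comp_inl, Sum.elim_comp_inr, stageCost, smul_eq_mul, zero_mulVec, dotProduct_zero]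
  simp only [← smul_add, mulVec_smul, dotProduct_smul, smul_dotProduct, smul_eq_mul]
  ring

theorem lmiM_isSymm (hQ : Q.IsSymm) (hH : H.IsSymm) : (lmiM A B Q γ μ H).IsSymm := by
  simp only [lmiM, IsSymm, fromBlocks_transpose, transpose_add, transpose_sub, transpose_smul,
    transpose_mul, transpose_transpose, transpose_zero, transpose_one, hQ.eq, 
    (toBlocks₁₁_isSymm hH).eq, (toBlocks₂₂_isSymm hH).eq, hH.eq,
    Matrix.mul_assoc]

theorem smul_one_posDef (hγ : 0 < γ) : (γ • (1 : Matrix (Fin m) (Fin m) ℝ)).PosDef :=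
  PosDef.one.smul hγ

/-- Both constraints reduce to `xᵀ P x ≤ [x; u]ᵀ H [x; u]`, the second one at the successor state
`μ(Ax + Bu)`. -/
theorem feasibleH_qMatrix (hQ : Q.PosSemidef) (hγ : 0 < γ) {P : Matrix (Fin n) (Fin n) ℝ}
    (hP : P.PosSemidef) (hfix : riccati (μ • A) (μ • B) Q (γ • 1) P = P) :
    FeasibleH A B Q γ μ (qMatrix (μ • A) (μ • B) Q (γ • 1) P) P := by
  have hR := smul_one_posDef (m := m) hγ
  have hH := qMatrix_isSymm (μ • A) (μ • B) hQ hR hP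
  have hge : ∀ x u, x ⬝ᵥ P *ᵥ x ≤ Sum.elim x u ⬝ᵥ qMatrix (μ • A) (μ • B) Q (γ • 1) P *ᵥ
      Sum.elim x u := by
    intro x u
    rw [qMatrix_quad]
    conv_lhs => rw [← hfix]
    exact riccati_quad_le _ _ hR hP x u
  refine ⟨hH, posSemidef_iff_isSymm.2 ⟨?_, fun z => ?_⟩, posSemidef_iff_isSymm.2
    ⟨lmiM_isSymm (isSymm_of_posSemidef hQ) hH, fun z => ?_⟩⟩
  · exact IsSymm.fromBlocks ((toBlocks₁₁_isSymm hH).sub (isSymm_of_posSemidef hP)) rfl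
      (toBlocks₂₂_isSymm hH)
  · have h := hge (z ∘ Sum.inl) (z ∘ Sum.inr)
    rw [quad_eq_blocks hH] at h
    rw [← Sum.elim_comp_inl_inr z, sumElim_dotProduct_fromBlocks, sub_mulVec, dotProduct_sub]
    linarith
  · rw [← Sum.elim_comp_inl_inr z, ← Sum.elim_comp_inl_inr (z ∘ Sum.inl), lmiM_quad hH]
    rw [qMatrix_quad (μ • A) (μ • B) ((z ∘ Sum.inl) ∘ Sum.inl)]
    have := hge ((μ • A) *ᵥ ((z ∘ Sum.inl) ∘ Sum.inl) + (μ • B) *ᵥ ((z ∘ Sum.inl) ∘ Sum.inr))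
      (z ∘ Sum.inr)
    linarith

/-- The `W`-part of a feasible point is bounded by a stabilizing Riccati solution. -/
theorem FeasibleH.quad_le (h : FeasibleH A B Q γ μ H W) (hγ : 0 < γ)
    {P : Matrix (Fin n) (Fin n) ℝ} (hP : P.PosSemidef)
    (hfix : riccati (μ • A) (μ • B) Q (γ • 1) P = P)
    (hstab : ∀ x, Tendsto (fun k => greedyLoop (μ • A) (μ • B) (γ • 1) P ^ k *ᵥ x) atTop (𝓝 0))
    (x : Fin n → ℝ) : x ⬝ᵥ W *ᵥ x ≤ x ⬝ᵥ P *ᵥ x := by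
  obtain ⟨hH, hW, hM⟩ := h
  have hR := smul_one_posDef (m := m) hγ
  set K := greedyGain (μ • A) (μ • B) (γ • 1) P
  set L := greedyLoop (μ • A) (μ • B) (γ • 1) P
  let q : (Fin n → ℝ) → ℝ := fun y => Sum.elim y (-(K *ᵥ y)) ⬝ᵥ H *ᵥ Sum.elim y (-(K *ᵥ y))
  have hqc : Continuous q := by
    simp only [q, quad_eq_blocks hH]
    fun_prop
  have hstep : ∀ y, q y ≤ stageCost Q (γ • 1) y (-(K *ᵥ y)) + q (L *ᵥ y) := by
    intro y
    -- The free last block of the constraint is the greedy input at the successor state, which turns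
    -- it into a one-step inequality for `q`.
    have := quad_nonneg hM (Sum.elim (Sum.elim y (-(K *ᵥ y))) (-(K *ᵥ (L *ᵥ y))))
    rw [lmiM_quad hH, mulVec_add_greedy] at this
    simp only [q]
    linarith
  have hT : ∀ T, q x ≤ x ⬝ᵥ P *ᵥ x + q (L ^ T *ᵥ x) := by
    intro T
    have h1 : q x ≤ ∑ j ∈ Finset.range T, stageCost Q (γ • 1) (L ^ j *ᵥ x) (-(K *ᵥ (L ^ j *ᵥ x)))
        + q (L ^ T *ᵥ x) := by
      induction T with
      | zero => simp
      | succ T ih =>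
        have := hstep (L ^ T *ᵥ x)
        rw [mulVec_mulVec x L, ← pow_succ'] at this
        rw [Finset.sum_range_succ]
        linarith
    rw [sum_stageCost_greedy (μ • A) (μ • B) hR hP hfix x T] at h1
    linarith [quad_nonneg hP (L ^ T *ᵥ x)]
  have hq0 : q 0 = 0 := by simp [q, quad_eq_blocks hH]
  have hlim : Tendsto (fun T => x ⬝ᵥ P *ᵥ x + q (L ^ T *ᵥ x)) atTop (𝓝 (x ⬝ᵥ P *ᵥ x + 0)) :=
    ((hq0 ▸ hqc.tendsto 0).comp (hstab x)).const_add _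
  have hqx : q x ≤ x ⬝ᵥ P *ᵥ x := by
    simpa using ge_of_tendsto' hlim hT
  -- The first constraint at the greedy input bounds the form of `W` by `q x`.
  have hWx := quad_nonneg hW (Sum.elim x (-(K *ᵥ x)))
  rw [sumElim_dotProduct_fromBlocks, sub_mulVec, dotProduct_sub] at hWx
  simp only [q, quad_eq_blocks hH] at hqx
  linarith

theorem isSolutionH_qMatrix (hQ : Q.PosSemidef) (hγ : 0 < γ) {P : Matrix (Fin n) (Fin n) ℝ}
    (hP : P.PosSemidef) (hfix : riccati (μ • A) (μ • B) Q (γ • 1) P = P)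
    (hstab : ∀ x, Tendsto (fun k => greedyLoop (μ • A) (μ • B) (γ • 1) P ^ k *ᵥ x) atTop (𝓝 0)) :
    IsSolutionH A B Q γ μ (qMatrix (μ • A) (μ • B) Q (γ • 1) P) P := by
  refine ⟨feasibleH_qMatrix hQ hγ hP hfix, fun H' W' h => Finset.sum_le_sum fun i _ => ?_⟩
  simpa using h.quad_le hγ hP hfix hstab (Pi.single i 1)

end FirstSDP

/-! ### Real quadratic forms on complex vectors -/

section ComplexForms

variable {ι κ : Type*} [Fintype ι] [Fintype κ]

/-- The Hermitian form `v* X v` of a real symmetric matrix `X`. -/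
def hermForm (X : Matrix ι ι ℝ) (v : ι → ℂ) : ℝ :=
  (fun i => (v i).re) ⬝ᵥ X *ᵥ (fun i => (v i).re) + (fun i => (v i).im) ⬝ᵥ X *ᵥ (fun i => (v i).im)

/-- By symmetry the mixed terms in the real and imaginary parts cancel. -/
theorem star_dotProduct_map_mulVec {X : Matrix ι ι ℝ} (hX : X.IsSymm) (v : ι → ℂ) :
    star v ⬝ᵥ X.map (algebraMap ℝ ℂ) *ᵥ v = hermForm X v := by
  have h := dotProduct_mulVec_symm hX (fun i => (v i).re) (fun i => (v i).im)
  apply Complex.ext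
  · simp [hermForm, dotProduct, mulVec, Finset.sum_add_distrib]
  · simp only [dotProduct, mulVec] at h
    simp [dotProduct, mulVec, Finset.sum_add_distrib, h]

theorem star_map_mulVec (X : Matrix κ ι ℝ) (v : ι → ℂ) (y : κ → ℂ) :
    star (X.map (algebraMap ℝ ℂ) *ᵥ v) ⬝ᵥ y = star v ⬝ᵥ Xᵀ.map (algebraMap ℝ ℂ) *ᵥ y := by
  rw [star_mulVec, ← dotProduct_mulVec]
  congr 2
  ext i j
  simp

theorem hermForm_nonneg {X : Matrix ι ι ℝ} (hX : X.PosSemidef) (v : ι → ℂ) : 0 ≤ hermForm X v :=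
  add_nonneg (quad_nonneg hX _) (quad_nonneg hX _)

theorem hermForm_smul {X : Matrix ι ι ℝ} (hX : X.IsSymm) (s : ℂ) (v : ι → ℂ) :
    hermForm X (s • v) = ‖s‖ ^ 2 * hermForm X v := by
  apply Complex.ofReal_injective
  push_cast
  rw [← star_dotProduct_map_mulVec hX, ← star_dotProduct_map_mulVec hX, mulVec_smul, star_smul,
    smul_dotProduct, dotProduct_smul, smul_eq_mul, smul_eq_mul, ← mul_assoc, ← Complex.conj_mul']
  rfl

omit [Fintype κ] in
theorem re_map_mulVec (X : Matrix κ ι ℝ) (v : ι → ℂ) :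
    (fun i => ((X.map (algebraMap ℝ ℂ) *ᵥ v) i).re) = X *ᵥ fun i => (v i).re := by
  ext i
  simp [mulVec, dotProduct]

omit [Fintype κ] in
theorem im_map_mulVec (X : Matrix κ ι ℝ) (v : ι → ℂ) :
    (fun i => ((X.map (algebraMap ℝ ℂ) *ᵥ v) i).im) = X *ᵥ fun i => (v i).im := by
  ext i
  simp [mulVec, dotProduct]

theorem hermForm_transpose_mul_self_eq_zero {X : Matrix κ ι ℝ} {v : ι → ℂ}
    (h : hermForm (Xᵀ * X) v = 0) : X.map (algebraMap ℝ ℂ) *ᵥ v = 0 := by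
  have hnn : ∀ x : ι → ℝ, x ⬝ᵥ (Xᵀ * X) *ᵥ x = (X *ᵥ x) ⬝ᵥ (X *ᵥ x) := by
    intro x
    rw [mulVec_dotProduct_eq, mulVec_mulVec]
  have hn : ∀ y : κ → ℝ, 0 ≤ y ⬝ᵥ y := fun y => Finset.sum_nonneg fun i _ => mul_self_nonneg _
  rw [hermForm, hnn, hnn] at h
  have h1 := dotProduct_self_eq_zero.1 (le_antisymm (by linarith [hn (X *ᵥ fun i => (v i).im)])
    (hn (X *ᵥ fun i => (v i).re)))
  have h2 := dotProduct_self_eq_zero.1 (le_antisymm (by linarith [hn (X *ᵥ fun i => (v i).re)])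
    (hn (X *ᵥ fun i => (v i).im)))
  rw [← re_map_mulVec] at h1
  rw [← im_map_mulVec] at h2
  ext i
  exact Complex.ext (congrFun h1 i) (congrFun h2 i)

end ComplexForms

/-! ### Stability of the modes -/

section Modes

variable {n m p : ℕ} {F : Matrix (Fin n) (Fin n) ℝ} {G : Matrix (Fin n) (Fin m) ℝ}
  {Q : Matrix (Fin n) (Fin n) ℝ} {γ : ℝ} {P : Matrix (Fin n) (Fin n) ℝ}

/-- The Lyapunov identity of the mode `F - z G K` along an eigenvector. -/
theorem hermForm_eigenvector (hγ : 0 < γ) (hP : P.PosSemidef) (hQ : Q.PosSemidef)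
    (hfix : riccati F G Q (γ • 1) P = P) {z s : ℂ} {v : Fin n → ℂ}
    (hv : F.map (algebraMap ℝ ℂ) *ᵥ v - z • G.map (algebraMap ℝ ℂ) *ᵥ
      ((greedyGain F G (γ • 1) P).map (algebraMap ℝ ℂ) *ᵥ v) = s • v) :
    ‖s‖ ^ 2 * hermForm P v = hermForm P v - hermForm Q v
      + ‖1 - z‖ ^ 2 * hermForm (inputHessian G (γ • 1) P)
          ((greedyGain F G (γ • 1) P).map (algebraMap ℝ ℂ) *ᵥ v)
      - γ * ‖z‖ ^ 2 * hermForm (1 : Matrix (Fin m) (Fin m) ℝ)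
          ((greedyGain F G (γ • 1) P).map (algebraMap ℝ ℂ) *ᵥ v) := by
  have hR := smul_one_posDef (m := m) hγ
  have hPs := isSymm_of_posSemidef hP
  have hSs := isSymm_of_posSemidef (inputHessian_posDef G hR hP).posSemidef
  have hSK := inputHessian_mul_greedyGain F G hR hP
  have hfix' := hfix
  rw [riccati] at hfix'
  set K := greedyGain F G (γ • 1) P with hK
  set S := inputHessian G (γ • 1) P with hS
  set w := K.map (algebraMap ℝ ℂ) *ᵥ v with hw
  rw [← hermForm_smul hPs, ← hv]
  apply Complex.ofReal_injective
  push_cast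
  rw [← star_dotProduct_map_mulVec hPs, ← star_dotProduct_map_mulVec hPs,
    ← star_dotProduct_map_mulVec hSs, ← star_dotProduct_map_mulVec isSymm_one,
    ← star_dotProduct_map_mulVec (isSymm_of_posSemidef hQ)]
  -- Both cross terms equal `w*Sw` because `S K = Gᵀ P F`. Then `e3` replaces `Gᵀ P G` by `S - γ`,
  -- and `e4` replaces `Fᵀ P F` through the Riccati equation.
  have e1 : star (G.map (algebraMap ℝ ℂ) *ᵥ w) ⬝ᵥ P.map (algebraMap ℝ ℂ) *ᵥ
      (F.map (algebraMap ℝ ℂ) *ᵥ v) = star w ⬝ᵥ S.map (algebraMap ℝ ℂ) *ᵥ w := by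
    rw [star_map_mulVec, hw, mulVec_mulVec, mulVec_mulVec, mulVec_mulVec, ← Matrix.map_mul,
      ← Matrix.map_mul, ← Matrix.map_mul, hSK, Matrix.mul_assoc]
  have e2 : star (F.map (algebraMap ℝ ℂ) *ᵥ v) ⬝ᵥ P.map (algebraMap ℝ ℂ) *ᵥ
      (G.map (algebraMap ℝ ℂ) *ᵥ w) = star w ⬝ᵥ S.map (algebraMap ℝ ℂ) *ᵥ w := by
    have hKS : Kᵀ * S = Fᵀ * P * G := by
      have := congrArg transpose hSK
      simpa [hSs.eq, hPs.eq, Matrix.mul_assoc] using this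
    rw [star_map_mulVec, hw, star_map_mulVec K, mulVec_mulVec, mulVec_mulVec, mulVec_mulVec,
      mulVec_mulVec, ← Matrix.map_mul, ← Matrix.map_mul, ← Matrix.map_mul, ← Matrix.map_mul,
      mulVec_mulVec, ← Matrix.map_mul, hKS]
  have e3 : star w ⬝ᵥ S.map (algebraMap ℝ ℂ) *ᵥ w =
      γ * (star w ⬝ᵥ (1 : Matrix (Fin m) (Fin m) ℝ).map (algebraMap ℝ ℂ) *ᵥ w) +
      star (G.map (algebraMap ℝ ℂ) *ᵥ w) ⬝ᵥ P.map (algebraMap ℝ ℂ) *ᵥ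
        (G.map (algebraMap ℝ ℂ) *ᵥ w) := by
    clear_value w
    have : S.map (algebraMap ℝ ℂ) = (γ : ℂ) • (1 : Matrix (Fin m) (Fin m) ℝ).map (algebraMap ℝ ℂ)
        + Gᵀ.map (algebraMap ℝ ℂ) * P.map (algebraMap ℝ ℂ) * G.map (algebraMap ℝ ℂ) := by
      rw [← Matrix.map_mul, ← Matrix.map_mul, hS, inputHessian]
      ext i j
      by_cases hij : i = j <;> simp [hij]
    rw [this, star_map_mulVec G, add_mulVec, dotProduct_add, smul_mulVec, dotProduct_smul,
      mulVec_mulVec, mulVec_mulVec, Matrix.mul_assoc, smul_eq_mul]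
  have e4 : star v ⬝ᵥ P.map (algebraMap ℝ ℂ) *ᵥ v = star v ⬝ᵥ Q.map (algebraMap ℝ ℂ) *ᵥ v
      + star (F.map (algebraMap ℝ ℂ) *ᵥ v) ⬝ᵥ P.map (algebraMap ℝ ℂ) *ᵥ
        (F.map (algebraMap ℝ ℂ) *ᵥ v) - star w ⬝ᵥ S.map (algebraMap ℝ ℂ) *ᵥ w := by
    have : P.map (algebraMap ℝ ℂ) = Q.map (algebraMap ℝ ℂ)
        + Fᵀ.map (algebraMap ℝ ℂ) * P.map (algebraMap ℝ ℂ) * F.map (algebraMap ℝ ℂ)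
        - Kᵀ.map (algebraMap ℝ ℂ) * S.map (algebraMap ℝ ℂ) * K.map (algebraMap ℝ ℂ) := by
      simp only [← Matrix.map_mul]
      conv_lhs => rw [← hfix']
      ext i j
      simp
    conv_lhs => rw [this]
    rw [hw, star_map_mulVec, star_map_mulVec]
    simp only [sub_mulVec, add_mulVec, dotProduct_add, dotProduct_sub, mulVec_mulVec,
      Matrix.mul_assoc]
  have hz : (‖1 - z‖ : ℂ) ^ 2 = 1 - z - star z + star z * z := by
    rw [← Complex.conj_mul']; simp; ring
  have hz' : (‖z‖ : ℂ) ^ 2 = star z * z := by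
    rw [← Complex.conj_mul']; rfl
  rw [hz, hz', e4]
  simp only [star_sub, star_smul, mulVec_sub, mulVec_smul, sub_dotProduct, dotProduct_sub,
    smul_dotProduct, dotProduct_smul, smul_eq_mul, e1, e2]
  rw [e3]
  ring

/-- Along the mode `F - z G K` every eigenvalue lies in the open unit disc, provided that the
Lyapunov decrement is nonnegative. -/
theorem eigenvalue_norm_lt_one (hγ : 0 < γ) (hP : P.PosSemidef) {C : Matrix (Fin p) (Fin n) ℝ}
    {A : Matrix (Fin n) (Fin n) ℝ} (hobs : Observable A C) {μ : ℝ} (hμ : μ ≠ 0)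
    (hfix : riccati (μ • A) G (Cᵀ * C) (γ • 1) P = P) {β : ℝ}
    (hβ : ∀ x, β ^ 2 * ((greedyGain (μ • A) G (γ • 1) P *ᵥ x) ⬝ᵥ inputHessian G (γ • 1) P *ᵥ
      (greedyGain (μ • A) G (γ • 1) P *ᵥ x)) ≤ x ⬝ᵥ (Cᵀ * C) *ᵥ x)
    {z : ℂ} (hz : ‖1 - z‖ ≤ β) (hz0 : z ≠ 0 ∨ 1 < β) {s : ℂ} {v : Fin n → ℂ} (hv0 : v ≠ 0)
    (hv : (μ • A).map (algebraMap ℝ ℂ) *ᵥ v - z • G.map (algebraMap ℝ ℂ) *ᵥ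
      ((greedyGain (μ • A) G (γ • 1) P).map (algebraMap ℝ ℂ) *ᵥ v) = s • v) : ‖s‖ < 1 := by
  by_contra! hs
  have hQ : (Cᵀ * C).PosSemidef := by
    simpa using posSemidef_conjTranspose_mul_self C
  have hR := smul_one_posDef (m := m) hγ
  have hid := hermForm_eigenvector hγ hP hQ hfix hv
  set K := greedyGain (μ • A) G (γ • 1) P
  set S := inputHessian G (γ • 1) P
  set w := K.map (algebraMap ℝ ℂ) *ᵥ v with hw
  have hp := hermForm_nonneg hP v
  have hσ := hermForm_nonneg (inputHessian_posDef G hR hP).posSemidef w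
  have hω := hermForm_nonneg (PosSemidef.one (n := Fin m) (R := ℝ)) w
  have hq : β ^ 2 * hermForm S w ≤ hermForm (Cᵀ * C) v := by
    have h1 := hβ fun i => (v i).re
    have h2 := hβ fun i => (v i).im
    rw [hermForm, hermForm, hw, re_map_mulVec, im_map_mulVec]
    linarith
  have hzβ : ‖1 - z‖ ^ 2 * hermForm S w ≤ β ^ 2 * hermForm S w := by gcongr
  have hsp : hermForm P v ≤ ‖s‖ ^ 2 * hermForm P v :=
    le_mul_of_one_le_left hp (one_le_pow₀ hs)
  have hzω : 0 ≤ γ * ‖z‖ ^ 2 * hermForm (1 : Matrix (Fin m) (Fin m) ℝ) w := by positivity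
  -- The chain `q ≤ |1 - z|² σ - γ|z|² ω ≤ |1 - z|² σ ≤ β² σ ≤ q` collapses, with `q`, `σ`, `ω` the
  -- forms of `CᵀC` at `v` and of `S` and `1` at `w`.
  have hqz : hermForm (Cᵀ * C) v = ‖1 - z‖ ^ 2 * hermForm S w := by linarith
  have hq0 : hermForm (Cᵀ * C) v = 0 ∧ z • w = 0 := by
    by_cases hz1 : z = 0
    · have hb : 1 < β := hz0.resolve_left (not_not.2 hz1)
      subst hz1
      have : hermForm S w = 0 := by
        simp only [sub_zero, norm_one, one_pow, one_mul] at hqz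
        have hb2 : 1 < β ^ 2 := one_lt_pow₀ hb two_ne_zero
        refine le_antisymm ?_ hσ
        nlinarith
      refine ⟨by rw [hqz, this, mul_zero], zero_smul _ _⟩
    · have hz2 : 0 < γ * ‖z‖ ^ 2 := by positivity
      have hω0 : hermForm (1 : Matrix (Fin m) (Fin m) ℝ) w = 0 :=
        (mul_eq_zero.1 (le_antisymm (by linarith) hzω)).resolve_left hz2.ne'
      have hw0 : w = 0 := by
        have := hermForm_transpose_mul_self_eq_zero (X := (1 : Matrix (Fin m) (Fin m) ℝ)) (v := w)
          (by simpa using hω0)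
        simpa using this
      refine ⟨?_, by rw [hw0, smul_zero]⟩
      rw [hqz, hw0]
      simp [hermForm]
  have hC := hermForm_transpose_mul_self_eq_zero hq0.1
  -- The feedback term vanishes, which leaves `μ A v = s v` with `C v = 0`.
  rw [← mulVec_smul, hq0.2, mulVec_zero, sub_zero] at hv
  refine hv0 (hobs.eigenvector_eq_zero (s := (μ : ℂ)⁻¹ * s) ?_ hC)
  have hA : (μ • A).map (algebraMap ℝ ℂ) = (μ : ℂ) • A.map (algebraMap ℝ ℂ) := by
    ext i j; simp
  rw [hA, smul_mulVec] at hv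
  rw [mul_smul, ← hv, smul_smul, inv_mul_cancel₀ (by exact_mod_cast hμ), one_smul]

end Modes

/-! ### Powers of stable matrices -/

section Powers

variable {n : ℕ}

theorem exists_eigenvector_of_mem_spectrum {M : Matrix (Fin n) (Fin n) ℂ} {s : ℂ}
    (hs : s ∈ spectrum ℂ M) : ∃ v : Fin n → ℂ, v ≠ 0 ∧ M *ᵥ v = s • v := by
  rw [← spectrum_toLin', ← Module.End.hasEigenvalue_iff_mem_spectrum] at hs
  obtain ⟨v, hv⟩ := hs.exists_hasEigenvector
  exact ⟨v, hv.2, by simpa using hv.apply_eq_smul⟩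

attribute [local instance] Matrix.linftyOpNormedAddCommGroup Matrix.linftyOpNormedRing
  Matrix.linftyOpNormedSpace Matrix.linftyOpNormedAlgebra

theorem spectralRadius_lt_of_eigenvectors {M : Matrix (Fin n) (Fin n) ℂ} {r : ℝ} (hr : 0 < r)
    (h : ∀ (s : ℂ) (v : Fin n → ℂ), v ≠ 0 → M *ᵥ v = s • v → ‖s‖ < r) :
    spectralRadius ℂ M < ENNReal.ofReal r := by
  rcases (spectrum ℂ M).eq_empty_or_nonempty with he | hne
  · simp [spectralRadius, he, hr]
  · rw [ENNReal.ofReal]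
    refine spectrum.spectralRadius_lt_of_forall_lt_of_nonempty hne fun s hs => ?_
    obtain ⟨v, hv0, hv⟩ := exists_eigenvector_of_mem_spectrum hs
    rw [← NNReal.coe_lt_coe, coe_nnnorm, Real.coe_toNNReal _ hr.le]
    exact h s v hv0 hv

/-- Gelfand's formula gives eventual domination by a geometric series. -/
theorem summable_norm_pow {M : Matrix (Fin n) (Fin n) ℂ} (h : spectralRadius ℂ M < 1) :
    Summable fun k => ‖M ^ k‖ := by
  obtain ⟨r, hr, hr1⟩ := ENNReal.lt_iff_exists_nnreal_btwn.1 h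
  have hr1' : r < 1 := by exact_mod_cast hr1
  have hev := (spectrum.pow_nnnorm_pow_one_div_tendsto_nhds_spectralRadius M).eventually_lt_const hr
  refine Summable.of_norm_bounded_eventually_nat (g := fun k => (r : ℝ) ^ k)
    (summable_geometric_of_lt_one r.2 hr1') ?_
  filter_upwards [hev, eventually_gt_atTop 0] with k hk hk0
  rw [one_div, ENNReal.rpow_inv_lt_iff (by exact_mod_cast hk0), ENNReal.rpow_natCast] at hk
  have : ‖M ^ k‖₊ < r ^ k := by exact_mod_cast hk
  rw [norm_norm]
  exact_mod_cast this.le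

/-- A stable linear recursion with a summable perturbation has summable solutions. -/
theorem summable_norm_of_recursion {M : Matrix (Fin n) (Fin n) ℂ} (h : spectralRadius ℂ M < 1)
    {y ε : ℕ → Fin n → ℂ} (hy : ∀ k, y (k + 1) = M *ᵥ y k + ε k)
    (hε : Summable fun k => ‖ε k‖) : Summable fun k => ‖y k‖ := by
  have hM := summable_norm_pow h
  -- Variation of constants: the forced part is a convolution of two summable sequences.
  have hsol : ∀ k, y (k + 1) = M ^ (k + 1) *ᵥ y 0 +
      ∑ ij ∈ Finset.HasAntidiagonal.antidiagonal k, M ^ ij.1 *ᵥ ε ij.2 := by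
    intro k
    induction k with
    | zero => simp [hy]
    | succ k ih =>
      rw [hy, ih, Finset.Nat.sum_antidiagonal_succ, mulVec_add, mulVec_mulVec, ← pow_succ',
        mulVec_sum]
      simp only [mulVec_mulVec, ← pow_succ', pow_zero, one_mulVec]
      abel
  rw [← summable_nat_add_iff 1]
  have hc := summable_norm_sum_mul_antidiagonal_of_summable_norm hM.norm hε.norm
  refine Summable.of_nonneg_of_le (fun _ => norm_nonneg _) (fun k => ?_)
    ((((summable_nat_add_iff 1).2 hM).mul_right ‖y 0‖).add hc)
  rw [hsol]
  refine (norm_add_le _ _).trans (add_le_add (linfty_opNorm_mulVec _ _) ?_)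
  refine (norm_sum_le _ _).trans ((Finset.sum_le_sum fun ij _ =>
    linfty_opNorm_mulVec (M ^ ij.1) (ε ij.2)).trans (le_abs_self _))

theorem summable_norm_mulVec {v : ℕ → Fin n → ℂ} (hv : Summable fun k => ‖v k‖)
    (M : Matrix (Fin n) (Fin n) ℂ) : Summable fun k => ‖M *ᵥ v k‖ :=
  Summable.of_nonneg_of_le (fun _ => norm_nonneg _) (fun _ => linfty_opNorm_mulVec M _)
    (hv.mul_left ‖M‖)

end Powers

/-! ### Laplacians of digraphs with a spanning tree -/

section Laplacian

variable {N : ℕ} {a : Matrix (Fin N) (Fin N) ℝ}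

theorem laplacian_mulVec_apply (a : Matrix (Fin N) (Fin N) ℝ) (v : Fin N → ℝ) (i : Fin N) :
    (laplacian a *ᵥ v) i = ∑ j, a i j * (v i - v j) := by
  rw [laplacian, sub_mulVec, Pi.sub_apply, mulVec_diagonal, Finset.sum_mul, mulVec, dotProduct,
    ← Finset.sum_sub_distrib]
  exact Finset.sum_congr rfl fun j _ => by ring

/-- Maximum principle: at a maximal node the row equation is a vanishing sum of nonnegative terms,
so every in-neighbour has the same value. This propagates back along the path to the root. -/
theorem eq_root_of_isMax {v : Fin N → ℝ} (ha : ∀ i j, 0 ≤ a i j) (hv : laplacian a *ᵥ v = 0)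
    {r i : Fin N} (hr : Relation.ReflTransGen (fun j i : Fin N => 0 < a i j) r i)
    (hi : ∀ j, v j ≤ v i) : v r = v i := by
  induction hr using Relation.ReflTransGen.head_induction_on with
  | refl => rfl
  | @head j k hjk _ ih =>
    have h := congrFun hv k
    rw [laplacian_mulVec_apply, Pi.zero_apply, Finset.sum_eq_zero_iff_of_nonneg
      fun l _ => mul_nonneg (ha _ _) (sub_nonneg.2 (ih ▸ hi l))] at h
    have := (mul_eq_zero.1 (h j (Finset.mem_univ j))).resolve_left hjk.ne'
    linarith

/-- The kernel of the Laplacian of a digraph with a spanning tree consists of the constants. -/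
theorem HasSpanningTree.apply_eq [NeZero N] (htree : HasSpanningTree a) (ha : ∀ i j, 0 ≤ a i j)
    {v : Fin N → ℝ} (hv : laplacian a *ᵥ v = 0) (i j : Fin N) : v i = v j := by
  obtain ⟨r, hr⟩ := htree
  obtain ⟨k, hk⟩ := Finite.exists_max v
  obtain ⟨l, hl⟩ := Finite.exists_min v
  have h1 := eq_root_of_isMax ha hv (hr k) hk
  have h2 := eq_root_of_isMax (v := -v) ha (by rw [mulVec_neg, hv, neg_zero]) (hr l)
    fun j => neg_le_neg (hl j)
  simp only [Pi.neg_apply, neg_inj] at h2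
  linarith [hk i, hk j, hl i, hl j]

/-- At a node where `v` is minimal the entry of the image is at most zero. This rules out Jordan
chains of length two above the constants. -/
theorem laplacian_mulVec_ne_one [NeZero N] (ha : ∀ i j, 0 ≤ a i j) (v : Fin N → ℝ) :
    laplacian a *ᵥ v ≠ 1 := by
  intro h
  obtain ⟨l, hl⟩ := Finite.exists_min v
  have := congrFun h l
  rw [laplacian_mulVec_apply, Pi.one_apply] at this
  have h0 : ∑ j, a l j * (v l - v j) ≤ 0 :=
    Finset.sum_nonpos fun j _ => mul_nonpos_of_nonneg_of_nonpos (ha _ _) (sub_nonpos.2 (hl j))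
  linarith

/-- The complexified Laplacian. -/
abbrev laplacianC (a : Matrix (Fin N) (Fin N) ℝ) : Matrix (Fin N) (Fin N) ℂ :=
  (laplacian a).map (algebraMap ℝ ℂ)

theorem laplacianC_mulVec_const (a : Matrix (Fin N) (Fin N) ℝ) (c : ℂ) :
    laplacianC a *ᵥ (fun _ => c) = 0 := by
  have h : ∀ t : ℝ, laplacian a *ᵥ (fun _ => t) = 0 := fun t => by
    ext i; rw [laplacian_mulVec_apply]; simp
  ext i
  apply Complex.ext
  · exact congrFun ((re_map_mulVec (laplacian a) fun _ => c).trans (h _)) i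
  · exact congrFun ((im_map_mulVec (laplacian a) fun _ => c).trans (h _)) i

theorem HasSpanningTree.apply_eq_complex [NeZero N] (htree : HasSpanningTree a)
    (ha : ∀ i j, 0 ≤ a i j) {v : Fin N → ℂ} (hv : laplacianC a *ᵥ v = 0) (i j : Fin N) :
    v i = v j := by
  apply Complex.ext
  · exact htree.apply_eq ha (v := fun i => (v i).re)
      (by rw [← re_map_mulVec, hv]; rfl) i j
  · exact htree.apply_eq ha (v := fun i => (v i).im)
      (by rw [← im_map_mulVec, hv]; rfl) i j

theorem laplacianC_mulVec_eq_const [NeZero N] (ha : ∀ i j, 0 ≤ a i j) {v : Fin N → ℂ} {c : ℂ}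
    (hv : laplacianC a *ᵥ v = fun _ => c) : c = 0 := by
  by_contra hc
  have h : laplacianC a *ᵥ (c⁻¹ • v) = fun _ => 1 := by
    rw [mulVec_smul, hv]; ext i; simp [hc]
  refine laplacian_mulVec_ne_one ha (fun i => ((c⁻¹ • v) i).re) ?_
  rw [← re_map_mulVec, h]
  ext i; simp

/-- The generalized kernel of the Laplacian of a digraph with a spanning tree consists of the
constants. -/
theorem HasSpanningTree.apply_eq_of_pow [NeZero N] (htree : HasSpanningTree a)
    (ha : ∀ i j, 0 ≤ a i j) {v : Fin N → ℂ} {k : ℕ} (hv : laplacianC a ^ k *ᵥ v = 0)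
    (i j : Fin N) : v i = v j := by
  have hker : ∀ k, laplacianC a ^ k *ᵥ v = 0 → laplacianC a *ᵥ v = 0 := by
    intro k
    induction k with
    | zero => intro h; rw [pow_zero, one_mulVec] at h; rw [h, mulVec_zero]
    | succ k ih =>
      intro h
      rcases Nat.eq_zero_or_pos k with rfl | hk
      · simpa using h
      · refine ih ?_
        obtain ⟨k, rfl⟩ := Nat.exists_eq_succ_of_ne_zero hk.ne'
        -- This vector is killed by the Laplacian, hence constant; being also in its range, it must
        -- vanish.
        have hc : laplacianC a ^ (k + 1) *ᵥ v = fun _ => (laplacianC a ^ (k + 1) *ᵥ v) 0 := by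
          ext i
          refine htree.apply_eq_complex ha ?_ i 0
          rw [mulVec_mulVec, ← pow_succ']
          exact h
        rw [hc, laplacianC_mulVec_eq_const ha
          (((mulVec_mulVec _ _ _).trans (congrArg (· *ᵥ v) (pow_succ' _ k).symm)).trans hc)]
        rfl
  exact htree.apply_eq_complex ha (hker k hv) i j

theorem mem_maxGenEigenspace_toLin' {M : Matrix (Fin N) (Fin N) ℂ} {z : ℂ} {v : Fin N → ℂ} :
    v ∈ Module.End.maxGenEigenspace M.toLin' z ↔
      ∃ k : ℕ, (M - z • (1 : Matrix (Fin N) (Fin N) ℂ)) ^ k *ᵥ v = 0 := by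
  rw [Module.End.mem_maxGenEigenspace]
  refine exists_congr fun k => ?_
  have : (M - z • (1 : Matrix (Fin N) (Fin N) ℂ)).toLin' = M.toLin' - z • 1 := by
    rw [map_sub, map_smul, toLin'_one]; rfl
  rw [← this, ← toLin'_pow, toLin'_apply]

/-- The algebraic multiplicity is the dimension of the generalized kernel, which lies in the line of
constants. -/
theorem rootMultiplicity_zero_laplacianC [NeZero N] (htree : HasSpanningTree a)
    (ha : ∀ i j, 0 ≤ a i j) : (laplacianC a).charpoly.rootMultiplicity 0 ≤ 1 := by
  rw [← charpoly_toLin', ← LinearMap.finrank_maxGenEigenspace_eq]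
  refine (Submodule.finrank_mono (t := Submodule.span ℂ {(1 : Fin N → ℂ)}) fun v hv => ?_).trans
    ((finrank_span_le_card _).trans (by simp))
  obtain ⟨k, hk⟩ := mem_maxGenEigenspace_toLin'.1 hv
  rw [zero_smul, sub_zero] at hk
  refine Submodule.mem_span_singleton.2 ⟨v 0, ?_⟩
  ext i
  simpa using htree.apply_eq_of_pow ha hk 0 i

theorem IsSpectrumList.ne_zero [NeZero N] {lam : Fin N → ℂ}
    (hlam : IsSpectrumList (laplacian a) lam) (htree : HasSpanningTree a)
    (ha : ∀ i j, 0 ≤ a i j) {i : Fin N} (hi : i ≠ 0) : lam i ≠ 0 := by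
  intro h
  have h1 := rootMultiplicity_zero_laplacianC htree ha
  rw [laplacianC, hlam.1] at h1
  have hdvd : (Polynomial.X - Polynomial.C (0 : ℂ)) ^ 2 ∣
      ∏ i, (Polynomial.X - Polynomial.C (lam i)) := by
    rw [sq, ← Finset.mul_prod_erase _ _ (Finset.mem_univ 0), hlam.2]
    refine mul_dvd_mul_left _ ?_
    have := Finset.dvd_prod_of_mem (fun i => Polynomial.X - Polynomial.C (lam i))
      (Finset.mem_erase.2 ⟨hi, Finset.mem_univ i⟩)
    simpa [h] using this
  have hne : ∏ i, (Polynomial.X - Polynomial.C (lam i)) ≠ 0 :=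
    Finset.prod_ne_zero_iff.2 fun i _ => Polynomial.X_sub_C_ne_zero _
  have := (Polynomial.le_rootMultiplicity_iff hne).2 hdvd
  omega

theorem IsSpectrumList.hasEigenvalue_iff [NeZero N] {L : Matrix (Fin N) (Fin N) ℝ}
    {lam : Fin N → ℂ} (hlam : IsSpectrumList L lam) {z : ℂ} :
    Module.End.HasEigenvalue (L.map (algebraMap ℝ ℂ)).toLin' z ↔ ∃ i, lam i = z := by
  rw [Module.End.hasEigenvalue_iff_isRoot_charpoly, charpoly_toLin', hlam.1,
    Polynomial.isRoot_prod]
  simp [sub_eq_zero, eq_comm]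

/-- Each Gershgorin disc has its radius equal to its centre `ρ ≥ 0`, so it meets the closed left
half-plane only at zero, which is excluded. -/
theorem IsSpectrumList.re_pos [NeZero N] {lam : Fin N → ℂ}
    (hlam : IsSpectrumList (laplacian a) lam) (htree : HasSpanningTree a)
    (ha : ∀ i j, 0 ≤ a i j) {i : Fin N} (hi : i ≠ 0) : 0 < (lam i).re := by
  have hne := hlam.ne_zero htree ha hi
  obtain ⟨k, hk⟩ := eigenvalue_mem_ball (A := laplacianC a) (hlam.hasEigenvalue_iff.2 ⟨i, rfl⟩)
  set ρ : ℝ := ∑ j ∈ Finset.univ.erase k, a k j with hρ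
  have h1 : laplacianC a k k = (ρ : ℂ) := by
    rw [hρ]
    have : laplacian a k k = ∑ j ∈ Finset.univ.erase k, a k j := by
      rw [laplacian, Matrix.sub_apply, diagonal_apply_eq,
        ← Finset.add_sum_erase _ _ (Finset.mem_univ k), add_sub_cancel_left]
    rw [← this]; rfl
  have h2 : ∑ j ∈ Finset.univ.erase k, ‖laplacianC a k j‖ = ρ := by
    refine Finset.sum_congr rfl fun j hj => ?_
    simp [laplacian, (Finset.ne_of_mem_erase hj).symm, abs_of_nonneg (ha k j)]
  have hρ0 : 0 ≤ ρ := Finset.sum_nonneg fun j _ => ha k j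
  rw [mem_closedBall_iff_norm, h1, h2] at hk
  have h3 : ‖lam i - ρ‖ ^ 2 ≤ ρ ^ 2 := by gcongr
  have h4 : 0 < ‖lam i‖ ^ 2 := by positivity
  rw [← Complex.normSq_eq_norm_sq, Complex.normSq_apply] at h3 h4
  simp only [Complex.sub_re, Complex.sub_im, Complex.ofReal_re, Complex.ofReal_im] at h3
  by_contra! hcon
  nlinarith [mul_nonneg hρ0 (neg_nonneg.2 hcon)]

end Laplacian

/-! ### The second semidefinite program -/

section SecondSDP

theorem posSemidef_fin_two_iff {β s t : ℝ} :
    (!![β - s, t; t, β + s] : Matrix (Fin 2) (Fin 2) ℝ).PosSemidef ↔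
      0 ≤ β ∧ s ^ 2 + t ^ 2 ≤ β ^ 2 := by
  constructor
  · intro h
    have h0 := h.diag_nonneg (i := 0)
    have h1 := h.diag_nonneg (i := 1)
    have hd := h.det_nonneg
    simp [det_fin_two] at h0 h1 hd
    exact ⟨by linarith, by nlinarith⟩
  · rintro ⟨hβ, h⟩
    refine posSemidef_iff_isSymm.2 ⟨?_, fun x => ?_⟩
    · ext i j
      fin_cases i <;> fin_cases j <;> rfl
    · have hq : x ⬝ᵥ !![β - s, t; t, β + s] *ᵥ x =
          β * (x 0 ^ 2 + x 1 ^ 2) + (2 * t * x 0 * x 1 - s * (x 0 ^ 2 - x 1 ^ 2)) := by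
        simp [dotProduct, mulVec, Fin.sum_univ_two]
        ring
      have hb : (2 * t * x 0 * x 1 - s * (x 0 ^ 2 - x 1 ^ 2)) ^ 2 ≤
          (β * (x 0 ^ 2 + x 1 ^ 2)) ^ 2 := by
        have h1 : (2 * t * x 0 * x 1 - s * (x 0 ^ 2 - x 1 ^ 2)) ^ 2 ≤
            (s ^ 2 + t ^ 2) * (x 0 ^ 2 + x 1 ^ 2) ^ 2 := by
          -- The hint is the complementary square in Lagrange's identity for `(-s, t)` and `(x₀² -
          -- x₁², 2x₀x₁)`; the latter has length `x₀² + x₁²`.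
          nlinarith [sq_nonneg (2 * s * x 0 * x 1 + t * (x 0 ^ 2 - x 1 ^ 2))]
        rw [mul_pow]
        exact h1.trans (by gcongr)
      rw [hq]
      linarith [neg_le_of_abs_le (abs_le_of_sq_le_sq hb (by positivity))]

theorem normSq_one_sub_mul (c : ℝ) (z : ℂ) :
    ‖1 - c * z‖ ^ 2 = 1 - 2 * c * z.re + c ^ 2 * ‖z‖ ^ 2 := by
  rw [← Complex.normSq_eq_norm_sq, ← Complex.normSq_eq_norm_sq, Complex.normSq_apply,
    Complex.normSq_apply]
  simp
  ring

theorem lmiN_posSemidef_iff {β c : ℝ} {z : ℂ} (hz : z ≠ 0) :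
    (lmiN β c z).PosSemidef ↔ ‖1 - c * z‖ ≤ β := by
  have hz' : 0 < ‖z‖ := norm_pos_iff.2 hz
  have hs : 0 ≤ 1 - z.re ^ 2 / ‖z‖ ^ 2 := by
    rw [sub_nonneg, div_le_one (by positivity)]
    exact sq_le_sq' (neg_le_of_abs_le (Complex.abs_re_le_norm z)) (Complex.re_le_norm z)
  have he : √(1 - z.re ^ 2 / ‖z‖ ^ 2) ^ 2 + (1 / ‖z‖ * (c * ‖z‖ ^ 2 - z.re)) ^ 2
      = ‖1 - c * z‖ ^ 2 := by
    rw [Real.sq_sqrt hs, normSq_one_sub_mul]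
    field_simp
    ring
  rw [lmiN, posSemidef_fin_two_iff, he]
  constructor
  · rintro ⟨h0, h⟩
    exact (abs_le_of_sq_le_sq' h h0).2
  · intro h
    exact ⟨(norm_nonneg _).trans h, by gcongr⟩

/-- A Schur complement by completing the square; the factorization `Xᵀ = S K` replaces the inverse
of `S`. -/
theorem fromBlocks_posSemidef_iff {n m : ℕ} {Q : Matrix (Fin n) (Fin n) ℝ} (hQ : Q.IsSymm)
    {S : Matrix (Fin m) (Fin m) ℝ} (hS : S.PosSemidef) {X : Matrix (Fin n) (Fin m) ℝ}
    {K : Matrix (Fin m) (Fin n) ℝ} (hX : Xᵀ = S * K) (β : ℝ) :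
    (fromBlocks Q (β • X) (β • Xᵀ) S).PosSemidef ↔
      ∀ x, β ^ 2 * ((K *ᵥ x) ⬝ᵥ S *ᵥ (K *ᵥ x)) ≤ x ⬝ᵥ Q *ᵥ x := by
  have hSs := isSymm_of_posSemidef hS
  have hquad : ∀ (x : Fin n → ℝ) (u : Fin m → ℝ),
      Sum.elim x u ⬝ᵥ fromBlocks Q (β • X) (β • Xᵀ) S *ᵥ Sum.elim x u =
        x ⬝ᵥ Q *ᵥ x - β ^ 2 * ((K *ᵥ x) ⬝ᵥ S *ᵥ (K *ᵥ x))
          + (u + β • (K *ᵥ x)) ⬝ᵥ S *ᵥ (u + β • (K *ᵥ x)) := by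
    intro x u
    have h1 : u ⬝ᵥ Xᵀ *ᵥ x = u ⬝ᵥ S *ᵥ (K *ᵥ x) := by rw [hX, mulVec_mulVec]
    have h2 : x ⬝ᵥ X *ᵥ u = u ⬝ᵥ S *ᵥ (K *ᵥ x) := by
      rw [← h1, dotProduct_comm, mulVec_dotProduct_eq]
    rw [sumElim_dotProduct_fromBlocks]
    simp only [smul_mulVec, dotProduct_smul, h1, h2, mulVec_add, mulVec_smul, dotProduct_add,
      add_dotProduct, smul_dotProduct, smul_eq_mul]
    rw [dotProduct_mulVec_symm hSs (K *ᵥ x) u]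
    ring
  constructor
  · intro h x
    have := quad_nonneg h (Sum.elim x (-(β • (K *ᵥ x))))
    rw [hquad] at this
    simp only [neg_add_cancel, mulVec_zero, dotProduct_zero] at this
    linarith
  · intro h
    refine posSemidef_iff_isSymm.2 ⟨IsSymm.fromBlocks hQ (by rw [transpose_smul]) hSs,
      fun z => ?_⟩
    rw [← Sum.elim_comp_inl_inr z, hquad]
    have := quad_nonneg hS (z ∘ Sum.inr + β • (K *ᵥ (z ∘ Sum.inl)))
    linarith [h (z ∘ Sum.inl)]

variable {n m N : ℕ} [NeZero N]

theorem feasibleBeta_iff {Q : Matrix (Fin n) (Fin n) ℝ} (hQ : Q.IsSymm)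
    {H : Matrix (Fin n ⊕ Fin m) (Fin n ⊕ Fin m) ℝ} (hS : H.toBlocks₂₂.PosSemidef)
    {K : Matrix (Fin m) (Fin n) ℝ} (hK : H.toBlocks₁₂ᵀ = H.toBlocks₂₂ * K) {lam : Fin N → ℂ}
    (hlam : ∀ i, i ≠ 0 → lam i ≠ 0) {β c : ℝ} :
    FeasibleBeta Q H lam β c ↔
      (∀ x, β ^ 2 * ((K *ᵥ x) ⬝ᵥ H.toBlocks₂₂ *ᵥ (K *ᵥ x)) ≤ x ⬝ᵥ Q *ᵥ x) ∧
        ∀ i, i ≠ 0 → ‖1 - c * lam i‖ ≤ β := by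
  rw [FeasibleBeta, fromBlocks_posSemidef_iff hQ hS hK]
  exact and_congr_right fun _ => forall₂_congr fun i hi => lmiN_posSemidef_iff (hlam i hi)

/-- The feasible set is compact: a vector with `K x ≠ 0` bounds `β`, and then `|c λ| ≤ 1 + β` bounds
`c`. -/
theorem exists_isSolutionBeta {Q : Matrix (Fin n) (Fin n) ℝ} (hQ : Q.IsSymm)
    {H : Matrix (Fin n ⊕ Fin m) (Fin n ⊕ Fin m) ℝ} (hS : H.toBlocks₂₂.PosDef)
    {K : Matrix (Fin m) (Fin n) ℝ} (hK : H.toBlocks₁₂ᵀ = H.toBlocks₂₂ * K) {lam : Fin N → ℂ}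
    (hlam : ∀ i, i ≠ 0 → lam i ≠ 0) (hN : ∃ i : Fin N, i ≠ 0)
    (hfeas : ∃ β c, FeasibleBeta Q H lam β c) (hH : H.toBlocks₁₂ ≠ 0) :
    ∃ β c, IsSolutionBeta Q H lam β c := by
  obtain ⟨i₀, hi₀⟩ := hN
  have hiff : ∀ {β c : ℝ}, _ := @feasibleBeta_iff n m N _ Q hQ H hS.posSemidef K hK lam hlam
  obtain ⟨x, hx⟩ : ∃ x, K *ᵥ x ≠ 0 := by
    by_contra! h
    refine hH (transpose_eq_zero.1 ?_)
    have : K = 0 := by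
      ext i j
      simpa using congrFun (h (Pi.single j 1)) i
    rw [hK, this, Matrix.mul_zero]
  have hσ : 0 < (K *ᵥ x) ⬝ᵥ H.toBlocks₂₂ *ᵥ (K *ᵥ x) := by
    simpa using hS.dotProduct_mulVec_pos hx
  set σ := (K *ᵥ x) ⬝ᵥ H.toBlocks₂₂ *ᵥ (K *ᵥ x) with hσdef
  set M := √((x ⬝ᵥ Q *ᵥ x) / σ)
  set D : Set (ℝ × ℝ) := {z | FeasibleBeta Q H lam z.1 z.2}
  have hDeq : D = (⋂ y, {z : ℝ × ℝ | z.1 ^ 2 * ((K *ᵥ y) ⬝ᵥ H.toBlocks₂₂ *ᵥ (K *ᵥ y))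
      ≤ y ⬝ᵥ Q *ᵥ y}) ∩ ⋂ i, ⋂ (_ : i ≠ 0), {z : ℝ × ℝ | ‖1 - (z.2 : ℂ) * lam i‖ ≤ z.1} := by
    ext z
    simp only [D, Set.mem_ofPred_eq, hiff, Set.mem_inter_iff, Set.mem_iInter]
  have hclosed : IsClosed D := by
    rw [hDeq]
    refine (isClosed_iInter fun y => isClosed_le (by fun_prop) (by fun_prop)).inter
      (isClosed_iInter fun i => isClosed_iInter fun _ => isClosed_le (by fun_prop) (by fun_prop))
  have hsub : D ⊆ Set.Icc 0 M ×ˢ Set.Icc (-((1 + M) / ‖lam i₀‖)) ((1 + M) / ‖lam i₀‖) := by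
    rintro ⟨β, c⟩ hz
    obtain ⟨h1, h2⟩ := hiff.1 hz
    have h3 := h2 i₀ hi₀
    have hβM : β ≤ M := Real.le_sqrt_of_sq_le (by rw [le_div_iff₀ hσ]; exact h1 x)
    have h4 : |c| * ‖lam i₀‖ ≤ 1 + M := by
      have : ‖(c : ℂ) * lam i₀‖ ≤ ‖(1 : ℂ)‖ + ‖1 - c * lam i₀‖ := by
        simpa using norm_sub_le (1 : ℂ) (1 - c * lam i₀)
      rw [norm_mul, Complex.norm_real, norm_one, Real.norm_eq_abs] at this
      linarith
    refine ⟨⟨(norm_nonneg _).trans h3, hβM⟩, abs_le.1 ?_⟩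
    exact (le_div_iff₀ (norm_pos_iff.2 (hlam i₀ hi₀))).2 h4
  have hcomp : IsCompact D :=
    (isCompact_Icc.prod isCompact_Icc).of_isClosed_subset hclosed hsub
  obtain ⟨β, c, hf⟩ := hfeas
  obtain ⟨z, hz, hmax⟩ := hcomp.exists_isMaxOn ⟨(β, c), hf⟩ continuous_fst.continuousOn
  exact ⟨z.1, z.2, hz, fun β' c' h => hmax (a := (β', c')) h⟩

end SecondSDP

/-! ### The coupling gain -/

section Coupling

variable {N : ℕ} [NeZero N] {lam : Fin N → ℂ} {β c : ℝ}

/-- Multiplying by `‖z‖ ^ 2` completes the square in `c`, which exhibits the admissible gains as an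
interval. -/
theorem norm_one_sub_mul_le_iff {z : ℂ} (hz : z ≠ 0) (hβ : 0 ≤ β) :
    ‖1 - c * z‖ ≤ β ↔ (c * ‖z‖ ^ 2 - z.re) ^ 2 ≤ z.re ^ 2 - ‖z‖ ^ 2 * (1 - β ^ 2) := by
  have hz' : 0 < ‖z‖ ^ 2 := by positivity
  rw [← sq_le_sq₀ (norm_nonneg _) hβ, normSq_one_sub_mul, ← mul_le_mul_iff_right₀ hz']
  constructor <;> intro h <;> nlinarith

theorem couplingGain_mem (hne : ∃ i : Fin N, i ≠ 0) (hlam : ∀ i, i ≠ 0 → 0 < (lam i).re)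
    (h : ∀ i, i ≠ 0 → ‖1 - c * lam i‖ ≤ β) :
    (∀ i, i ≠ 0 → ‖1 - couplingGain lam β * lam i‖ ≤ β) ∧
      (β ≤ 1 → 0 < couplingGain lam β) := by
  obtain ⟨i₀, hi₀⟩ := hne
  have : Nonempty {i : Fin N // i ≠ 0} := ⟨⟨i₀, hi₀⟩⟩
  have hβ : 0 ≤ β := (norm_nonneg _).trans (h i₀ hi₀)
  have hz : ∀ i, i ≠ 0 → lam i ≠ 0 := fun i hi h0 => by simpa [h0] using hlam i hi
  have hz2 : ∀ i, i ≠ 0 → 0 < ‖lam i‖ ^ 2 := fun i hi => by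
    have := norm_pos_iff.2 (hz i hi); positivity
  have hD : ∀ i, i ≠ 0 → |c * ‖lam i‖ ^ 2 - (lam i).re| ≤
      √((lam i).re ^ 2 - ‖lam i‖ ^ 2 * (1 - β ^ 2)) := fun i hi =>
    Real.abs_le_sqrt ((norm_one_sub_mul_le_iff (hz i hi) hβ).1 (h i hi))
  have h1 : c₁ lam β ≤ c := ciSup_le fun i => by
    rw [div_le_iff₀ (hz2 i i.2)]
    linarith [neg_le_of_abs_le (hD i i.2)]
  have h2 : c ≤ c₂ lam β := le_ciInf fun i => by
    rw [le_div_iff₀ (hz2 i i.2)]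
    linarith [le_of_abs_le (hD i i.2)]
  have hlow : ∀ i : {i : Fin N // i ≠ 0},
      ((lam i).re - √((lam i).re ^ 2 - ‖lam i‖ ^ 2 * (1 - β ^ 2))) / ‖lam i‖ ^ 2 ≤ c₁ lam β :=
    fun i => le_ciSup (f := fun i : {i : Fin N // i ≠ 0} =>
      ((lam i).re - √((lam i).re ^ 2 - ‖lam i‖ ^ 2 * (1 - β ^ 2))) / ‖lam i‖ ^ 2)
      (Set.finite_range _).bddAbove i
  have hupp : ∀ i : {i : Fin N // i ≠ 0}, c₂ lam β ≤
      ((lam i).re + √((lam i).re ^ 2 - ‖lam i‖ ^ 2 * (1 - β ^ 2))) / ‖lam i‖ ^ 2 :=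
    fun i => ciInf_le (f := fun i : {i : Fin N // i ≠ 0} =>
      ((lam i).re + √((lam i).re ^ 2 - ‖lam i‖ ^ 2 * (1 - β ^ 2))) / ‖lam i‖ ^ 2)
      (Set.finite_range _).bddBelow i
  have hc1 : c₁ lam β ≤ couplingGain lam β := by rw [couplingGain]; linarith
  have hc2 : couplingGain lam β ≤ c₂ lam β := by rw [couplingGain]; linarith
  constructor
  · intro i hi
    have hl := (hlow ⟨i, hi⟩).trans hc1
    have hu := hc2.trans (hupp ⟨i, hi⟩)
    rw [div_le_iff₀ (hz2 i hi)] at hl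
    rw [le_div_iff₀ (hz2 i hi)] at hu
    rw [norm_one_sub_mul_le_iff (hz i hi) hβ]
    rw [← Real.sq_sqrt ((sq_nonneg _).trans ((norm_one_sub_mul_le_iff (hz i hi) hβ).1 (h i hi)))]
    exact sq_le_sq' (by linarith) (by linarith)
  · intro hβ1
    -- For `β ≤ 1` the radicand is at most the square of the real part, so the lower endpoint at
    -- `i₀` is nonnegative.
    have hl : 0 ≤ c₁ lam β := by
      refine le_trans (div_nonneg ?_ (hz2 i₀ hi₀).le) (hlow ⟨i₀, hi₀⟩)
      rw [sub_nonneg, Real.sqrt_le_left (hlam i₀ hi₀).le]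
      have : 0 ≤ 1 - β ^ 2 := by nlinarith
      nlinarith [mul_nonneg (hz2 i₀ hi₀).le this]
    have hu : 0 < c₂ lam β := by
      obtain ⟨i, hi⟩ := exists_eq_ciInf_of_finite (f := fun i : {i : Fin N // i ≠ 0} =>
        ((lam i).re + √((lam i).re ^ 2 - ‖lam i‖ ^ 2 * (1 - β ^ 2))) / ‖lam i‖ ^ 2)
      rw [c₂, ← hi]
      exact div_pos (add_pos_of_pos_of_nonneg (hlam i i.2) (Real.sqrt_nonneg _)) (hz2 i i.2)
    rw [couplingGain]
    linarith

end Coupling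

/-! ### Consensus -/

section Consensus

variable {n m N : ℕ} (A : Matrix (Fin n) (Fin n) ℝ) (B : Matrix (Fin n) (Fin m) ℝ)
  (a : Matrix (Fin N) (Fin N) ℝ) (c : ℝ) (K : Matrix (Fin m) (Fin n) ℝ)

theorem row_mul_transpose {R : Type*} [CommSemiring R] (X : Matrix (Fin N) (Fin n) R)
    (Y : Matrix (Fin n) (Fin n) R) (i : Fin N) : (X * Yᵀ) i = Y *ᵥ X i := by
  ext l
  simp [mul_apply, mulVec, dotProduct, mul_comm]

/-- One step of the complexified closed loop, on the matrix whose rows are the agents' states. -/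
def closedLoopStep : Module.End ℂ (Matrix (Fin N) (Fin n) ℂ) where
  toFun Z := Z * (A.map (algebraMap ℝ ℂ))ᵀ
    - (c : ℂ) • (laplacianC a * Z * ((B * K).map (algebraMap ℝ ℂ))ᵀ)
  map_add' Z Z' := by
    simp only [Matrix.mul_add, Matrix.add_mul, smul_add]; abel
  map_smul' r Z := by
    simp only [Matrix.mul_smul, Matrix.smul_mul, smul_sub, RingHom.id_apply, smul_comm r (c : ℂ)]

variable {A B a c K}

theorem closedLoopStep_apply (Z : Matrix (Fin N) (Fin n) ℂ) :
    closedLoopStep A B a c K Z = Z * (A.map (algebraMap ℝ ℂ))ᵀ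
      - (c : ℂ) • (laplacianC a * Z * ((B * K).map (algebraMap ℝ ℂ))ᵀ) := rfl

/-- The agent dynamics act on the right and the Laplacian on the left, so left factors that commute
with the Laplacian pass through. -/
theorem closedLoopStep_pow_mul {Y : Matrix (Fin N) (Fin N) ℂ} (hY : Commute Y (laplacianC a))
    (Z : Matrix (Fin N) (Fin n) ℂ) (k : ℕ) :
    (closedLoopStep A B a c K ^ k) (Y * Z) = Y * (closedLoopStep A B a c K ^ k) Z := by
  induction k with
  | zero => simp
  | succ k ih =>
    rw [pow_succ', Module.End.mul_apply, Module.End.mul_apply, ih, closedLoopStep_apply,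
      closedLoopStep_apply, Matrix.mul_sub, Matrix.mul_smul]
    simp only [← Matrix.mul_assoc, hY.eq]

/-- Splitting the Laplacian as `z + (L - z)` separates the mode matrix from a forcing term one
Jordan level lower. -/
theorem closedLoopStep_row (Z : Matrix (Fin N) (Fin n) ℂ) (z : ℂ) (i : Fin N) :
    closedLoopStep A B a c K Z i = modeMatrix A B c K z *ᵥ Z i +
      (-(c : ℂ) • (B * K).map (algebraMap ℝ ℂ)) *ᵥ
        (((laplacianC a - z • (1 : Matrix (Fin N) (Fin N) ℂ)) * Z) i) := by
  have h : laplacianC a * Z =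
      (laplacianC a - z • (1 : Matrix (Fin N) (Fin N) ℂ)) * Z + z • Z := by
    rw [Matrix.sub_mul, Matrix.smul_mul, Matrix.one_mul, sub_add_cancel]
  have h' : ∀ X Y : Matrix (Fin N) (Fin n) ℂ, (X - (c : ℂ) • Y) i = X i - (c : ℂ) • Y i :=
    fun _ _ => rfl
  have h'' : ∀ X : Matrix (Fin N) (Fin n) ℂ, (X + z • Z) i = X i + z • Z i := fun _ => rfl
  rw [closedLoopStep_apply, h', row_mul_transpose, row_mul_transpose, h, h'', modeMatrix,
    sub_mulVec, smul_mulVec, smul_mulVec, mulVec_add, mulVec_smul, smul_add, smul_smul, neg_smul]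
  abel

/-- The closed loop is stable on the generalized eigenspaces of the Laplacian that belong to
stable modes. -/
theorem summable_closedLoop {z : ℂ} (hz : spectralRadius ℂ (modeMatrix A B c K z) < 1) {j : ℕ}
    {Z : Matrix (Fin N) (Fin n) ℂ}
    (hZ : (laplacianC a - z • (1 : Matrix (Fin N) (Fin N) ℂ)) ^ j * Z = 0) (i : Fin N) :
    Summable fun k => ‖(closedLoopStep A B a c K ^ k) Z i‖ := by
  induction j generalizing Z with
  | zero =>
    obtain rfl : Z = 0 := by simpa using hZ
    have h0 : (0 : Matrix (Fin N) (Fin n) ℂ) i = 0 := rfl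
    simp only [map_zero, h0, norm_zero]
    exact summable_zero
  | succ j ih =>
    have hcomm : Commute (laplacianC a - z • (1 : Matrix (Fin N) (Fin N) ℂ)) (laplacianC a) :=
      (Commute.refl _).sub_left ((Commute.one_left _).smul_left z)
    refine summable_norm_of_recursion hz (fun k => ?_) (summable_norm_mulVec
      (ih (Z := (laplacianC a - z • (1 : Matrix (Fin N) (Fin N) ℂ)) * Z)
        (by rw [← Matrix.mul_assoc, ← pow_succ, hZ]))
      (-(c : ℂ) • (B * K).map (algebraMap ℝ ℂ)))
    rw [closedLoopStep_pow_mul hcomm, pow_succ', Module.End.mul_apply]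
    exact closedLoopStep_row _ z i

variable (A B a c K) in
/-- The initial states from which the complexified closed loop reaches consensus. -/
def consensusSubmodule : Submodule ℂ (Matrix (Fin N) (Fin n) ℂ) where
  carrier := {Z | ∀ i j l, Tendsto (fun k => (closedLoopStep A B a c K ^ k) Z i l -
    (closedLoopStep A B a c K ^ k) Z j l) atTop (𝓝 0)}
  add_mem' {Z Z'} h h' i j l := by
    simpa [add_sub_add_comm] using (h i j l).add (h' i j l)
  zero_mem' i j l := by simp
  smul_mem' r Z h i j l := by
    simpa [mul_sub] using (h i j l).const_mul r

theorem mem_consensusSubmodule_of_summable {Z : Matrix (Fin N) (Fin n) ℂ}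
    (h : ∀ i, Summable fun k => ‖(closedLoopStep A B a c K ^ k) Z i‖) :
    Z ∈ consensusSubmodule A B a c K := by
  intro i j l
  have hi : ∀ i, Tendsto (fun k => (closedLoopStep A B a c K ^ k) Z i l) atTop (𝓝 0) := fun i =>
    (tendsto_pi_nhds.1 (tendsto_zero_iff_norm_tendsto_zero.2 (h i).tendsto_atTop_zero)) l
  simpa using (hi i).sub (hi j)

/-- The orbit stays in the kernel of the Laplacian, where all rows agree. -/
theorem mem_consensusSubmodule_of_ker [NeZero N] (htree : HasSpanningTree a)
    (ha : ∀ i j, 0 ≤ a i j) {Z : Matrix (Fin N) (Fin n) ℂ} (h : laplacianC a * Z = 0) :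
    Z ∈ consensusSubmodule A B a c K := by
  intro i j l
  have heq : ∀ k, (closedLoopStep A B a c K ^ k) Z i l =
      (closedLoopStep A B a c K ^ k) Z j l := by
    intro k
    refine htree.apply_eq_complex ha
      (v := fun i => (closedLoopStep A B a c K ^ k) Z i l) ?_ i j
    have hk := closedLoopStep_pow_mul (A := A) (B := B) (c := c) (K := K)
      (Commute.refl (laplacianC a)) Z k
    rw [h, map_zero] at hk
    ext i
    exact (congrFun (congrFun hk i) l).symm
  simp only [heq, sub_self]
  exact tendsto_const_nhds

/-- If all modes of nonzero eigenvalues are stable, then every state leads to consensus. -/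
theorem consensusSubmodule_eq_top [NeZero N] (htree : HasSpanningTree a)
    (ha : ∀ i j, 0 ≤ a i j) {lam : Fin N → ℂ} (hlam : IsSpectrumList (laplacian a) lam)
    (hmode : ∀ i, i ≠ 0 → spectralRadius ℂ (modeMatrix A B c K (lam i)) < 1) :
    consensusSubmodule A B a c K = ⊤ := by
  -- Rank-one matrices `v yᵀ` transfer the decomposition of `ℂ^N` into generalized eigenspaces to
  -- the matrices of agent states.
  let φ : (Fin n → ℂ) → (Fin N → ℂ) →ₗ[ℂ] Matrix (Fin N) (Fin n) ℂ := fun y =>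
    { toFun := fun v => vecMulVec v y
      map_add' := fun v w => add_vecMulVec v w y
      map_smul' := fun r v => smul_vecMulVec r v y }
  have hφ : ∀ y v, vecMulVec v y ∈ consensusSubmodule A B a c K := by
    intro y
    suffices h : (consensusSubmodule A B a c K).comap (φ y) = ⊤ from fun v =>
      (h ▸ Submodule.mem_top : v ∈ (consensusSubmodule A B a c K).comap (φ y))
    rw [eq_top_iff, ← Module.End.iSup_maxGenEigenspace_eq_top (laplacianC a).toLin']
    refine iSup_le fun z v hv => ?_
    obtain ⟨k, hk⟩ := mem_maxGenEigenspace_toLin'.1 hv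
    show vecMulVec v y ∈ consensusSubmodule A B a c K
    by_cases hz : z = 0
    · rw [hz, zero_smul, sub_zero] at hk
      refine mem_consensusSubmodule_of_ker htree ha ?_
      have hv0 : v = fun _ => v 0 := by
        ext i
        exact htree.apply_eq_of_pow ha hk i 0
      rw [mul_vecMulVec, hv0, laplacianC_mulVec_const, zero_vecMulVec]
    · by_cases hv0 : v = 0
      · rw [hv0, zero_vecMulVec]
        exact Submodule.zero_mem _
      · have hev : Module.End.HasEigenvalue (laplacianC a).toLin' z := by
          refine Module.End.HasUnifEigenvalue.lt (k := ⊤) zero_lt_one fun hbot => hv0 ?_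
          exact (Submodule.eq_bot_iff _).1 hbot v hv
        obtain ⟨i, rfl⟩ := hlam.hasEigenvalue_iff.1 hev
        have hi : i ≠ 0 := fun h => hz (h ▸ hlam.2)
        exact mem_consensusSubmodule_of_summable
          (summable_closedLoop (hmode i hi) (by rw [mul_vecMulVec, hk, zero_vecMulVec]))
  refine eq_top_iff.2 fun Z _ => ?_
  have hZ : Z = ∑ l, vecMulVec (fun i => Z i l) (Pi.single l 1) := by
    ext i l
    simp [Matrix.sum_apply, vecMulVec_apply, Pi.single_apply]
  rw [hZ]
  exact Submodule.sum_mem _ fun l _ => hφ _ _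

theorem IsClosedLoop.step {x : ℕ → Fin N → Fin n → ℝ} (h : IsClosedLoop A B a c K x) (k : ℕ) :
    (Matrix.of (x (k + 1))).map (algebraMap ℝ ℂ) =
      closedLoopStep A B a c K ((Matrix.of (x k)).map (algebraMap ℝ ℂ)) := by
  have hreal : Matrix.of (x (k + 1)) = Matrix.of (x k) * Aᵀ
      - c • (laplacian a * Matrix.of (x k) * (B * K)ᵀ) := by
    have hL : ∀ i, ∑ j, a i j • (x k i - x k j) = (laplacian a * Matrix.of (x k)) i := by
      intro i
      ext l
      have := laplacian_mulVec_apply a (fun j => x k j l) i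
      simp only [mulVec, dotProduct] at this
      simp [mul_apply, this]
    ext i l
    have h' : ∀ X Y : Matrix (Fin N) (Fin n) ℝ, (X - c • Y) i l = X i l - c * Y i l :=
      fun _ _ => rfl
    rw [h', row_mul_transpose, row_mul_transpose, of_apply, h k i, hL, mulVec_neg, mulVec_smul,
      mulVec_mulVec]
    simp only [sub_eq_add_neg]
    rfl
  rw [hreal, closedLoopStep_apply, ← transpose_map, ← transpose_map, laplacianC, ← Matrix.map_mul,
    ← Matrix.map_mul, ← Matrix.map_mul]
  ext i l
  simp

theorem reachesConsensus_of_modes [NeZero N] (htree : HasSpanningTree a)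
    (ha : ∀ i j, 0 ≤ a i j) {lam : Fin N → ℂ} (hlam : IsSpectrumList (laplacian a) lam)
    (hmode : ∀ i, i ≠ 0 → spectralRadius ℂ (modeMatrix A B c K (lam i)) < 1) :
    ReachesConsensus A B a c K := by
  intro x hx i j
  have hk : ∀ k, (Matrix.of (x k)).map (algebraMap ℝ ℂ) =
      (closedLoopStep A B a c K ^ k) ((Matrix.of (x 0)).map (algebraMap ℝ ℂ)) := by
    intro k
    induction k with
    | zero => rfl
    | succ k ih => rw [hx.step, ih, pow_succ', Module.End.mul_apply]
  have hmem : (Matrix.of (x 0)).map (algebraMap ℝ ℂ) ∈ consensusSubmodule A B a c K := by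
    rw [consensusSubmodule_eq_top htree ha hlam hmode]
    exact Submodule.mem_top
  refine tendsto_zero_iff_norm_tendsto_zero.1 (tendsto_pi_nhds.2 fun l => ?_)
  have h := hmem i j l
  simp only [← hk] at h
  simpa [Function.comp_def] using (Complex.continuous_re.tendsto 0).comp h

end Consensus

/-! ### Synthesis -/

section Synthesis

variable {n m p : ℕ} {A : Matrix (Fin n) (Fin n) ℝ} {B : Matrix (Fin n) (Fin m) ℝ}
  {C : Matrix (Fin p) (Fin n) ℝ} {γ μ : ℝ} {P : Matrix (Fin n) (Fin n) ℝ}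

/-- The greedy closed loop of a Riccati solution is stable. -/
theorem tendsto_greedyLoop_pow (hobs : Observable A C) (hγ : 0 < γ) (hμ : μ ≠ 0)
    (hP : P.PosSemidef) (hfix : riccati (μ • A) (μ • B) (Cᵀ * C) (γ • 1) P = P) (x : Fin n → ℝ) :
    Tendsto (fun k => greedyLoop (μ • A) (μ • B) (γ • 1) P ^ k *ᵥ x) atTop (𝓝 0) := by
  set L := greedyLoop (μ • A) (μ • B) (γ • 1) P with hL
  have hQ : (Cᵀ * C).PosSemidef := by simpa using posSemidef_conjTranspose_mul_self C
  have hρ : spectralRadius ℂ (L.map (algebraMap ℝ ℂ)) < 1 := by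
    rw [← ENNReal.ofReal_one]
    -- The greedy loop is the mode `z = 1`, where `|1 - z| = 0` permits `β = 0`.
    refine spectralRadius_lt_of_eigenvectors one_pos fun s v hv0 hv =>
      eigenvalue_norm_lt_one (β := 0) (z := 1) hγ hP hobs hμ hfix (fun x => ?_) (by simp)
        (Or.inl one_ne_zero) hv0 ?_
    · simpa using quad_nonneg hQ x
    · rw [← hv, hL, greedyLoop, Matrix.map_sub _ (map_sub _), Matrix.map_mul, sub_mulVec, one_smul,
        mulVec_mulVec]
  have hy : Summable fun k => ‖(fun i => (((L ^ k *ᵥ x) i : ℝ) : ℂ))‖ := by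
    refine summable_norm_of_recursion (ε := 0) hρ (fun k => ?_)
      (by simp)
    rw [pow_succ', ← mulVec_mulVec, Pi.zero_apply, add_zero]
    ext i
    simp [mulVec, dotProduct]
  have ht := tendsto_zero_iff_norm_tendsto_zero.2 hy.tendsto_atTop_zero
  refine tendsto_pi_nhds.2 fun i => ?_
  simpa [Function.comp_def] using (Complex.continuous_re.tendsto 0).comp (tendsto_pi_nhds.1 ht i)

theorem gainK_qMatrix (F : Matrix (Fin n) (Fin n) ℝ) (G : Matrix (Fin n) (Fin m) ℝ)
    (Q : Matrix (Fin n) (Fin n) ℝ) (R : Matrix (Fin m) (Fin m) ℝ) (hP : P.PosSemidef) :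
    gainK (qMatrix F G Q R P) = greedyGain F G R P := by
  simp [gainK, qMatrix, greedyGain, Matrix.mul_assoc, (isSymm_of_posSemidef hP).eq]

/-- Multiplying the mode by `μ` gives a mode of the scaled system `(μA, μB)`, whose eigenvalues lie
in the open unit disc. -/
theorem spectralRadius_modeMatrix_lt (hobs : Observable A C) (hγ : 0 < γ) (hμ : 0 < μ)
    (hP : P.PosSemidef) (hfix : riccati (μ • A) (μ • B) (Cᵀ * C) (γ • 1) P = P) {β : ℝ}
    (hβ : ∀ x, β ^ 2 * ((greedyGain (μ • A) (μ • B) (γ • 1) P *ᵥ x) ⬝ᵥ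
      inputHessian (μ • B) (γ • 1) P *ᵥ (greedyGain (μ • A) (μ • B) (γ • 1) P *ᵥ x)) ≤
        x ⬝ᵥ (Cᵀ * C) *ᵥ x)
    {c : ℝ} {z : ℂ} (hz : ‖1 - c * z‖ ≤ β) (hz0 : (c : ℂ) * z ≠ 0 ∨ 1 < β) :
    spectralRadius ℂ (modeMatrix A B c (greedyGain (μ • A) (μ • B) (γ • 1) P) z) <
      ENNReal.ofReal (1 / μ) := by
  refine spectralRadius_lt_of_eigenvectors (by positivity) fun s v hv0 hv => ?_
  have h : ‖(μ : ℂ) * s‖ < 1 := by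
    refine eigenvalue_norm_lt_one hγ hP hobs hμ.ne' hfix hβ hz hz0 hv0 ?_
    have hmap : ∀ {ι κ : Type} (X : Matrix ι κ ℝ),
        (μ • X).map (algebraMap ℝ ℂ) = (μ : ℂ) • X.map (algebraMap ℝ ℂ) := by
      intros; ext i j; simp
    rw [mul_smul (μ : ℂ) s v, ← hv, modeMatrix, hmap, hmap, Matrix.map_mul, sub_mulVec, smul_sub, smul_mulVec,
      smul_mulVec, smul_mulVec, mulVec_mulVec, smul_comm (μ : ℂ)]
  rw [norm_mul, Complex.norm_real, Real.norm_of_nonneg hμ.le] at h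
  rw [lt_div_iff₀ hμ]
  linarith

end Synthesis

end QConsensus

end

theorem theorem4 (n m p N : ℕ) [NeZero N] (hN : 2 ≤ N)
    (A : Matrix (Fin n) (Fin n) ℝ) (B : Matrix (Fin n) (Fin m) ℝ)
    (hAB : QConsensus.Controllable A B)
    (C : Matrix (Fin p) (Fin n) ℝ) (hAC : QConsensus.Observable A C)
    (Q : Matrix (Fin n) (Fin n) ℝ) (hQ : Q = Cᵀ * C)
    (γ μ : ℝ) (hγ : 0 < γ) (hμ : 1 ≤ μ)
    (a : Matrix (Fin N) (Fin N) ℝ) (ha : ∀ i j, 0 ≤ a i j)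
    (htree : QConsensus.HasSpanningTree a)
    (lam : Fin N → ℂ) (hlam : QConsensus.IsSpectrumList (QConsensus.laplacian a) lam) :
    (∃! H : Matrix (Fin n ⊕ Fin m) (Fin n ⊕ Fin m) ℝ,
      QConsensus.IsOptimalQMatrix (μ • A) (μ • B) Q (γ • 1) H ∧
        ∃ W, QConsensus.IsSolutionH A B Q γ μ H W) ∧
    ∀ (H : Matrix (Fin n ⊕ Fin m) (Fin n ⊕ Fin m) ℝ) (W : Matrix (Fin n) (Fin n) ℝ),
      QConsensus.IsSolutionH A B Q γ μ H W →
      QConsensus.IsOptimalQMatrix (μ • A) (μ • B) Q (γ • 1) H →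
      ((∃ β chat, QConsensus.FeasibleBeta Q H lam β chat) → H.toBlocks₁₂ ≠ 0 →
        ∃ β chat, QConsensus.IsSolutionBeta Q H lam β chat) ∧
      ∀ β chat : ℝ, QConsensus.IsSolutionBeta Q H lam β chat →
        QConsensus.ReachesConsensus A B a
          (QConsensus.couplingGain lam β) (QConsensus.gainK H) ∧
        ∀ i, i ≠ 0 →
          spectralRadius ℂ (QConsensus.modeMatrix A B
            (QConsensus.couplingGain lam β) (QConsensus.gainK H) (lam i))
            < ENNReal.ofReal (1 / μ) := by
  open QConsensus in
  subst hQ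
  have hμ0 : 0 < μ := one_pos.trans_le hμ
  have hQ : (Cᵀ * C).PosSemidef := by simpa using posSemidef_conjTranspose_mul_self C
  have hR := smul_one_posDef (m := m) hγ
  obtain ⟨P, hP, hfix, hle⟩ := exists_riccati_fixedPoint (μ • A) (μ • B) hQ hR
    (hAB.lqrCosts_nonempty hμ0.ne' (Cᵀ * C) (γ • 1))
  have hopt := isOptimalQMatrix_qMatrix (μ • A) (μ • B) hQ hR hP hfix hle
  refine ⟨⟨_, ⟨hopt, P, isSolutionH_qMatrix hQ hγ hP hfix
    (tendsto_greedyLoop_pow hAC hγ hμ0.ne' hP hfix)⟩, fun H' h => h.1.unique hopt⟩,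
    fun H W _ hH => ?_⟩
  obtain rfl := hH.unique hopt
  have hS : (qMatrix (μ • A) (μ • B) (Cᵀ * C) (γ • 1) P).toBlocks₂₂.PosDef := by
    rw [qMatrix, toBlocks_fromBlocks₂₂]
    exact inputHessian_posDef (μ • B) hR hP
  have hK : (qMatrix (μ • A) (μ • B) (Cᵀ * C) (γ • 1) P).toBlocks₁₂ᵀ =
      (qMatrix (μ • A) (μ • B) (Cᵀ * C) (γ • 1) P).toBlocks₂₂ *
        greedyGain (μ • A) (μ • B) (γ • 1) P := by
    rw [qMatrix, toBlocks_fromBlocks₁₂, toBlocks_fromBlocks₂₂,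
      inputHessian_mul_greedyGain _ _ hR hP]
    simp only [transpose_mul, transpose_transpose, (isSymm_of_posSemidef hP).eq, Matrix.mul_assoc]
  have hlam0 : ∀ i, i ≠ 0 → lam i ≠ 0 := fun i hi => hlam.ne_zero htree ha hi
  have hne : ∃ i : Fin N, i ≠ 0 :=
    ⟨⟨1, by omega⟩, fun h => by simpa using congrArg Fin.val h⟩
  refine ⟨exists_isSolutionBeta (isSymm_of_posSemidef hQ) hS hK hlam0 hne, fun β chat hβ => ?_⟩
  obtain ⟨hβQ, hβlam⟩ := (feasibleBeta_iff (isSymm_of_posSemidef hQ) hS.posSemidef hK hlam0).1 hβ.1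
  obtain ⟨hc, hcpos⟩ := couplingGain_mem hne (fun i hi => hlam.re_pos htree ha hi) hβlam
  have hmode : ∀ i, i ≠ 0 → spectralRadius ℂ (modeMatrix A B (couplingGain lam β)
      (gainK (qMatrix (μ • A) (μ • B) (Cᵀ * C) (γ • 1) P)) (lam i)) < ENNReal.ofReal (1 / μ) := by
    intro i hi
    rw [gainK_qMatrix _ _ _ _ hP]
    refine spectralRadius_modeMatrix_lt hAC hγ hμ0 hP hfix hβQ (hc i hi) ?_
    -- When `β > 1` the midpoint gain may vanish; the strict inequality then replaces `c λᵢ ≠ 0`.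
    rcases lt_or_ge 1 β with h | h
    · exact Or.inr h
    · exact Or.inl (mul_ne_zero (by exact_mod_cast (hcpos h).ne') (hlam0 i hi))
  refine ⟨reachesConsensus_of_modes htree ha hlam fun i hi => (hmode i hi).trans_le ?_, hmode⟩
  rw [ENNReal.ofReal_le_one, div_le_one hμ0]
  exact hμ
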